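/- Let $m\in\mathbb{N}$ and let $y=\{y_k;\,k\in\mathbb{Z}\}$ be an $\mathbb{R}^m$-valued, zero-mean, stationary Gaussian process on a probability space. Its covariance lags are $C_l:=\mathbb{E}[y_{k+l}y_k^\top]$, $l\in\mathbb{Z}$, and its spectral measure $F$ is the bounded, non-negative Hermitian matrix-valued measure on $(-\pi,\pi]$ with $C_l=\frac{1}{2\pi}\int_{(-\pi,\pi]}e^{\mathrm{j}l\vartheta}\,dF(\vartheta)$ for all $l\in\mathbb{Z}$. For real $\vartheta_1,\vartheta_2$ put $$\chi_k(\vartheta_1,\vartheta_2):=\frac{e^{-\mathrm{j}\vartheta_2k}-e^{-\mathrm{j}\vartheta_1k}}{-2\pi\mathrm{j}k}\quad(k\ne0),\qquad \chi_0(\vartheta_1,\vartheta_2):=\frac{\vartheta_2-\vartheta_1}{2\pi},$$ and let the spectral increments be defined by $$\hat y(e^{\mathrm{j}\vartheta_1},e^{\mathrm{j}\vartheta_2}):=\lim_{N\to\infty}\sum_{k=-N}^{N}\chi_k(\vartheta_1,\vartheta_2)\,y_k\qquad\text{(limit in mean square)},$$ understood as functions of the angles $\vartheta_1,\vartheta_2$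 (so that $-\pi$ and $\pi$ are distinguished), up to almost sure equality. Then: 1. For all $\vartheta_1,\vartheta_2\in[-\pi,\pi]$ the limit defining $\hat y(e^{\mathrm{j}\vartheta_1},e^{\mathrm{j}\vartheta_2})$ exists in mean square. 2. For all $\vartheta_1,\vartheta_2\in(-\pi,\pi]$, almost surely $\hat y(e^{-\mathrm{j}\vartheta_2},e^{-\mathrm{j}\vartheta_1})=\overline{\hat y(e^{\mathrm{j}\vartheta_1},e^{\mathrm{j}\vartheta_2})}$. 3. Let $\vartheta_1,\vartheta_2\in(-\pi,\pi]$ have the same sign, i.e. both are $\ge0$ or both are $\le0$. If $\vartheta_1\neq\vartheta_2$, suppose moreover that $F(\{\tau\})=0$ for every $\tau\in\{\vartheta_1,\vartheta_2\}\cap\{0,\pi\}$ (no condition if neither angle is $0$ or $\pi$; automatic if $F$ is absolutely continuous). Then $Z:=\hat y(e^{\mathrm{j}\vartheta_1},e^{\mathrm{j}\vartheta_2})$ is a circularly symmetric, normally distributed random vector: its real and imaginary parts are jointly Gaussian (possibly degenerate), $\mathbb{E}[Z]=0$ and $\mathbb{E}[ZZ^\top]=0$. 4. Let $\vartheta_1,\vartheta_2,\vartheta_3,\vartheta_4\in(-\pi,\pi]$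 with $\vartheta_1\le\vartheta_2$, $\vartheta_3\le\vartheta_4$ and $[\vartheta_1,\vartheta_2]\cap[\vartheta_3,\vartheta_4]=[\vartheta_1,\vartheta_2]\cap[-\vartheta_4,-\vartheta_3]=\emptyset$. Then $\hat y(e^{\mathrm{j}\vartheta_1},e^{\mathrm{j}\vartheta_2})$ and $\hat y(e^{\mathrm{j}\vartheta_3},e^{\mathrm{j}\vartheta_4})$ are independent random vectors. -/

import Mathlib

open MeasureTheory ProbabilityTheory Filter Topology
open scoped ComplexOrder

noncomputable section

namespace SpectralRep

variable {Ω : Type*} [MeasurableSpace Ω] {m : ℕ}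

/-- A family `y = {y_k ; k ∈ ℤ}` of `ℝ^m`-valued random vectors is a zero-mean, stationary,
Gaussian process: all finite families of its components are jointly Gaussian, every `y_k` has
mean zero, and the covariance `E[y_{k+l} y_kᵀ]` does not depend on `k`. (For a zero-mean Gaussian
process this second-order condition is the same as shift invariance of the law.) -/
structure IsStationaryGaussian (μ : Measure Ω) (y : ℤ → Ω → EuclideanSpace ℝ (Fin m)) :
    Prop where
  gaussian : IsGaussianProcess y μ
  mean_zero : ∀ (k : ℤ) (i : Fin m), ∫ ω, y k ω i ∂μ = 0
  stationary : ∀ (k l : ℤ) (i j : Fin m),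
    ∫ ω, y (k + l) ω i * y k ω j ∂μ = ∫ ω, y l ω i * y 0 ω j ∂μ

/-- The covariance lags `C_l = E[y_{k+l} y_kᵀ]`, evaluated at `k = 0`. -/
def covLag (μ : Measure Ω) (y : ℤ → Ω → EuclideanSpace ℝ (Fin m)) (l : ℤ) :
    Matrix (Fin m) (Fin m) ℝ :=
  Matrix.of fun i j => ∫ ω, y l ω i * y 0 ω j ∂μ

/-- `F` is a spectral measure of `y`: a (bounded) non-negative Hermitian matrix-valued measure
on `(-π, π]` with `C_l = (2π)⁻¹ ∫ e^{jlϑ} dF(ϑ)` for all `l`. -/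
structure IsSpectralMeasure (μ : Measure Ω) (y : ℤ → Ω → EuclideanSpace ℝ (Fin m))
    (F : Fin m → Fin m → ComplexMeasure ℝ) : Prop where
  supported : ∀ (i j : Fin m) (A : Set ℝ), MeasurableSet A →
    Disjoint A (Set.Ioc (-Real.pi) Real.pi) → F i j A = 0
  nonneg : ∀ A : Set ℝ, MeasurableSet A →
    (Matrix.of fun i j => F i j A : Matrix (Fin m) (Fin m) ℂ).PosSemidef
  covLag_eq : ∀ (l : ℤ) (i j : Fin m),
    ((covLag μ y l i j : ℝ) : ℂ) =
      (2 * (Real.pi : ℂ))⁻¹ *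
        ∫ᵛ t, Complex.exp (Complex.I * l * (t : ℂ)) ∂[ContinuousLinearMap.mul ℝ ℂ; F i j]

/-- The spectral measure of `y` has no mass at the frequency `τ ∈ (-π, π]`. -/
def NoSpectralMassAt (μ : Measure Ω) (y : ℤ → Ω → EuclideanSpace ℝ (Fin m)) (τ : ℝ) : Prop :=
  ∃ F : Fin m → Fin m → ComplexMeasure ℝ,
    IsSpectralMeasure μ y F ∧ ∀ i j : Fin m, F i j {τ} = 0

/-- The coefficients `χ_k(ϑ₁, ϑ₂)`. -/
def chi (k : ℤ) (t₁ t₂ : ℝ) : ℂ :=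
  if k = 0 then ((t₂ : ℂ) - t₁) / (2 * Real.pi)
  else (Complex.exp (-Complex.I * t₂ * k) - Complex.exp (-Complex.I * t₁ * k)) /
    (-2 * Real.pi * Complex.I * k)

/-- The partial sums `∑_{k=-N}^{N} χ_k(ϑ₁, ϑ₂) y_k`. -/
def partialSum (y : ℤ → Ω → EuclideanSpace ℝ (Fin m)) (t₁ t₂ : ℝ) (N : ℕ) (ω : Ω) :
    EuclideanSpace ℂ (Fin m) :=
  ∑ k ∈ Finset.Icc (-(N : ℤ)) (N : ℤ),
    chi k t₁ t₂ • (WithLp.toLp 2 fun i : Fin m => ((y k ω i : ℝ) : ℂ))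

/-- `Z` is the mean-square limit of the partial sums `∑_{k=-N}^{N} χ_k(ϑ₁, ϑ₂) y_k`. -/
structure IsSpectralIncrement (μ : Measure Ω) (y : ℤ → Ω → EuclideanSpace ℝ (Fin m))
    (t₁ t₂ : ℝ) (Z : Ω → EuclideanSpace ℂ (Fin m)) : Prop where
  memLp : MemLp Z 2 μ
  tendsto : Tendsto (fun N : ℕ => eLpNorm (fun ω => partialSum y t₁ t₂ N ω - Z ω) 2 μ)
    atTop (𝓝 0)

open Classical in
/-- The spectral increment `ŷ(e^{jϑ₁}, e^{jϑ₂})`, as a function of the angles `ϑ₁, ϑ₂`: a version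
of the mean-square limit of the partial sums (and `0` should the limit not exist). -/
def yhat (μ : Measure Ω) (y : ℤ → Ω → EuclideanSpace ℝ (Fin m)) (t₁ t₂ : ℝ) :
    Ω → EuclideanSpace ℂ (Fin m) :=
  if h : ∃ Z : Ω → EuclideanSpace ℂ (Fin m), IsSpectralIncrement μ y t₁ t₂ Z then h.choose
  else 0

/-- A `ℂ^m`-valued random vector `Z = α + jβ` is circularly symmetric normally distributed:
`α` and `β` are jointly Gaussian, `E[Z] = 0` and `E[Z Zᵀ] = 0`. Degenerate Gaussian laws are
allowed. -/
structure IsCircularlySymmetricGaussian (μ : Measure Ω) (Z : Ω → EuclideanSpace ℂ (Fin m)) :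
    Prop where
  gaussian : HasGaussianLaw
    (fun ω => ((fun i => (Z ω i).re, fun i => (Z ω i).im) : (Fin m → ℝ) × (Fin m → ℝ))) μ
  mean_zero : ∀ i : Fin m, ∫ ω, Z ω i ∂μ = 0
  pseudoCov_zero : ∀ i j : Fin m, ∫ ω, Z ω i * Z ω j ∂μ = 0

end SpectralRep

end

/-! The partial sum `∑ χ_k y_k` is the image of the trigonometric polynomial `chiPoly`, the
symmetric Fourier partial sum of the indicator of an arc, under the correspondence `e^{jkt} ↦ y_k`.
For a scalar stationary sequence, Herglotz' theorem supplies a finite measure `ν` on `(-π, π]`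
making this correspondence isometric, so inner products of partial sums are integrals of products of
such polynomials (`inner_chiSum_eq_integral`).

By `chiPoly_eq` each polynomial is, up to a constant, a difference of two translates of the sawtooth
sum `∑ sin(kx)/k`. These sums are bounded uniformly in `N` and `x` and converge pointwise, so
dominated convergence applies for every finite `ν`, atoms included. Hence the partial sums are
Cauchy, and two increments are orthogonal when one of the two limit kernels vanishes at `ν`-almost
every frequency; a kernel vanishes off its closed arc.

Polarization passes from scalar sequences to pairs of components. Atoms of `ν` are excluded without
comparing `ν` with `F`: by Wiener's lemma, an atom shows in the Cesàro means of the modulated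
covariance lags, and those means are computed from `F` as well.

Since `y` is real, conjugating an increment reflects its arc. Thus `E[Z Zᵀ]` is an inner product of
increments over an arc and its mirror image, which for angles of one sign meet at most at `0` and
`π`. Mean-square limits of Gaussian vectors are Gaussian, so vanishing covariance and
pseudo-covariance give independence. -/

noncomputable section

namespace SpectralRep

/-! ### Sawtooth Fourier sums: uniform bound and pointwise limit -/

/-- Abel's inequality: a sum with antitone nonnegative weights is bounded by the first weight times
a bound for the unweighted partial sums. -/
theorem abs_sum_mul_le_of_antitone {a z : ℕ → ℝ} {b : ℝ} (ha : Antitone a) (ha0 : ∀ n, 0 ≤ a n)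
    (hz : ∀ n, |∑ k ∈ Finset.range n, z k| ≤ b) (N : ℕ) :
    |∑ k ∈ Finset.range N, a k * z k| ≤ a 0 * b := by
  have key : ∀ N, ∑ k ∈ Finset.range N, a k * z k = a N * ∑ k ∈ Finset.range N, z k +
      ∑ k ∈ Finset.range N, (a k - a (k + 1)) * ∑ j ∈ Finset.range (k + 1), z j := by
    intro N
    induction N with
    | zero => simp
    | succ n ih =>
      rw [Finset.sum_range_succ, ih, Finset.sum_range_succ (fun k => (a k - a (k + 1)) * _),
        Finset.sum_range_succ z]
      ring
  rw [key]
  calc _ ≤ |a N * ∑ k ∈ Finset.range N, z k| + ∑ k ∈ Finset.range N,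
        |(a k - a (k + 1)) * ∑ j ∈ Finset.range (k + 1), z j| :=
        (abs_add_le _ _).trans (by gcongr; exact Finset.abs_sum_le_sum_abs _ _)
    _ ≤ a N * b + ∑ k ∈ Finset.range N, (a k - a (k + 1)) * b := by
        gcongr with k _
        · rw [abs_mul, abs_of_nonneg (ha0 N)]
          exact mul_le_mul_of_nonneg_left (hz _) (ha0 _)
        · have : 0 ≤ a k - a (k + 1) := sub_nonneg.2 (ha (Nat.le_succ k))
          rw [abs_mul, abs_of_nonneg this]
          exact mul_le_mul_of_nonneg_left (hz _) this
    _ = a 0 * b := by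
        rw [← Finset.sum_mul, Finset.sum_range_sub']; ring

theorem abs_sin_nat_mul_le (n : ℕ) (x : ℝ) : |Real.sin (n * x)| ≤ n * |Real.sin x| := by
  induction n with
  | zero => simp
  | succ n ih =>
    push_cast
    rw [add_mul, one_mul, Real.sin_add]
    calc _ ≤ |Real.sin (n * x)| * |Real.cos x| + |Real.cos (n * x)| * |Real.sin x| := by
          rw [← abs_mul, ← abs_mul]; exact abs_add_le _ _
      _ ≤ n * |Real.sin x| * 1 + 1 * |Real.sin x| := by
          gcongr
          · exact Real.abs_cos_le_one _
          · exact Real.abs_cos_le_one _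
      _ = _ := by ring

/-- Multiplication by `2 sin(x/2)` makes the sum telescope into two cosines. The starting index is
free because tails of the sawtooth sum need the same bound. -/
theorem abs_sum_sin_le {x : ℝ} (hx : Real.sin (x / 2) ≠ 0) (n M : ℕ) :
    |∑ k ∈ Finset.range M, Real.sin (((n + k : ℕ) : ℝ) * x)| ≤ |Real.sin (x / 2)|⁻¹ := by
  have key : 2 * Real.sin (x / 2) * ∑ k ∈ Finset.range M, Real.sin (((n + k : ℕ) : ℝ) * x) =
      Real.cos (n * x - x / 2) - Real.cos ((n + M : ℕ) * x - x / 2) := by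
    induction M with
    | zero => simp
    | succ M ih =>
      rw [Finset.sum_range_succ, mul_add, ih]
      have h1 : (((n + (M + 1) : ℕ) : ℝ) * x - x / 2) = ((n + M : ℕ) : ℝ) * x + x / 2 := by
        push_cast; ring
      rw [h1, Real.cos_add, Real.cos_sub (((n + M : ℕ) : ℝ) * x)]
      ring
  have h2 : 2 * |Real.sin (x / 2)| * |∑ k ∈ Finset.range M, Real.sin (((n + k : ℕ) : ℝ) * x)| ≤
      2 := by
    have := congrArg abs key
    rw [abs_mul, abs_mul, abs_two] at this
    rw [this]
    refine (abs_sub _ _).trans ?_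
    linarith [Real.abs_cos_le_one (n * x - x / 2), Real.abs_cos_le_one ((n + M : ℕ) * x - x / 2)]
  have h3 : 0 < |Real.sin (x / 2)| := abs_pos.2 hx
  rw [← one_div, le_div_iff₀ h3]
  linarith

/-- Partial sums of the sawtooth Fourier series `∑ sin (k x) / k`. -/
def sinSum (N : ℕ) (x : ℝ) : ℝ := ∑ k ∈ Finset.range (N + 1), Real.sin (k * x) / k

/-- The term `k = 0` of `sinSum` is `0 / 0 = 0`, so dropping it costs nothing. -/
theorem sinSum_eq (N : ℕ) (x : ℝ) :
    sinSum N x = ∑ k ∈ Finset.range N, ((k : ℝ) + 1)⁻¹ * Real.sin (((1 + k : ℕ) : ℝ) * x) := by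
  rw [sinSum, Finset.sum_range_succ']
  simp [div_eq_inv_mul, add_comm]

/-- Each term is at most `|sin x| ≤ 2 |sin(x/2)|`, because `|sin(kx)| ≤ k |sin x|`. This is the
efficient estimate while `N |sin(x/2)|` is at most `1`. -/
theorem abs_sinSum_le_mul (N : ℕ) (x : ℝ) : |sinSum N x| ≤ N * (2 * |Real.sin (x / 2)|) := by
  have h1 : |Real.sin x| ≤ 2 * |Real.sin (x / 2)| := by
    have : Real.sin x = 2 * Real.sin (x / 2) * Real.cos (x / 2) := by
      rw [← Real.sin_two_mul]; ring_nf
    rw [this, abs_mul, abs_mul, abs_two]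
    exact mul_le_of_le_one_right (by positivity) (Real.abs_cos_le_one _)
  rw [sinSum_eq]
  refine (Finset.abs_sum_le_sum_abs _ _).trans ?_
  refine (Finset.sum_le_card_nsmul _ _ (2 * |Real.sin (x / 2)|) fun k _ => ?_).trans (by simp)
  rw [abs_mul, abs_of_pos (by positivity), inv_mul_le_iff₀ (by positivity)]
  refine (abs_sin_nat_mul_le _ _).trans ?_
  push_cast
  rw [add_comm (1 : ℝ)]
  gcongr

/-- With `d = |sin(x/2)|`, the sum is cut at `n = ⌊1/d⌋`: the head is at most `2nd ≤ 2` term by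
term, and the tail at most `1/((n+1)d) ≤ 1` by Abel's inequality. -/
theorem abs_sinSum_le (N : ℕ) (x : ℝ) : |sinSum N x| ≤ 3 := by
  rcases eq_or_ne (Real.sin (x / 2)) 0 with hx | hx
  · have := abs_sinSum_le_mul N x
    rw [hx] at this
    simp at this
    simp [this]
  have hd : 0 < |Real.sin (x / 2)| := abs_pos.2 hx
  set d := |Real.sin (x / 2)| with hd_def
  set n := ⌊d⁻¹⌋₊ with hn
  have hn1 : (n : ℝ) * d ≤ 1 := by
    have := Nat.floor_le (inv_nonneg.2 hd.le)
    calc (n : ℝ) * d ≤ d⁻¹ * d := by gcongr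
      _ = 1 := inv_mul_cancel₀ hd.ne'
  have hn2 : ((n : ℝ) + 1)⁻¹ * d⁻¹ ≤ 1 := by
    rw [inv_mul_le_iff₀ (by positivity), mul_one]
    exact (Nat.lt_floor_add_one _).le
  rcases le_total N n with h | h
  · have := abs_sinSum_le_mul N x
    have h' : (N : ℝ) ≤ n := by exact_mod_cast h
    nlinarith
  · obtain ⟨M, rfl⟩ := Nat.exists_eq_add_of_le h
    have hsplit : sinSum (n + M) x = sinSum n x + ∑ k ∈ Finset.range M,
        (((n + k : ℕ) : ℝ) + 1)⁻¹ * Real.sin (((n + 1 + k : ℕ) : ℝ) * x) := by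
      rw [sinSum_eq, sinSum_eq, Finset.sum_range_add]
      congr 1
      refine Finset.sum_congr rfl fun k _ => ?_
      congr 4
      ring
    have htail : |∑ k ∈ Finset.range M,
        (((n + k : ℕ) : ℝ) + 1)⁻¹ * Real.sin (((n + 1 + k : ℕ) : ℝ) * x)| ≤
        (((n + 0 : ℕ) : ℝ) + 1)⁻¹ * d⁻¹ := by
      refine abs_sum_mul_le_of_antitone (a := fun k => (((n + k : ℕ) : ℝ) + 1)⁻¹) ?_ ?_ ?_ M
      · intro i j hij
        dsimp only
        gcongr
      · intro k; positivity
      · intro j; exact abs_sum_sin_le hx (n + 1) j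
    rw [hsplit]
    have h1 := abs_sinSum_le_mul n x
    rw [← hd_def] at h1
    refine (abs_add_le _ _).trans ?_
    simp only [add_zero] at htail
    linarith

/-- The polar form is `1 - e^{jx} = 2 sin(x/2) e^{j(x-π)/2}`, whose modulus is positive on the given
range. -/
theorem arg_one_sub_exp {x : ℝ} (h0 : 0 < x) (h1 : x < 2 * Real.pi) :
    (1 - Complex.exp (x * Complex.I)).arg = (x - Real.pi) / 2 := by
  have hs : 0 < 2 * Real.sin (x / 2) := by
    have := Real.sin_pos_of_pos_of_lt_pi (x := x / 2) (by linarith) (by linarith)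
    linarith
  have h : 1 - Complex.exp (x * Complex.I) =
      ((2 * Real.sin (x / 2) : ℝ) : ℂ) * (Complex.cos (((x - Real.pi) / 2 : ℝ) : ℂ) +
        Complex.sin (((x - Real.pi) / 2 : ℝ) : ℂ) * Complex.I) := by
    have e1 : Real.cos ((x - Real.pi) / 2) = Real.sin (x / 2) := by
      rw [← Real.cos_pi_div_two_sub, ← Real.cos_neg]; ring_nf
    have e2 : Real.sin ((x - Real.pi) / 2) = - Real.cos (x / 2) := by
      rw [sub_div, Real.sin_sub_pi_div_two]
    have e3 : Real.cos x = 1 - 2 * Real.sin (x / 2) ^ 2 := by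
      have := Real.cos_two_mul (x / 2)
      rw [show 2 * (x / 2) = x by ring] at this
      rw [this, Real.cos_sq']; ring
    have e4 : Real.sin x = 2 * Real.sin (x / 2) * Real.cos (x / 2) := by
      rw [← Real.sin_two_mul]; ring_nf
    rw [Complex.exp_mul_I, ← Complex.ofReal_cos, ← Complex.ofReal_sin, ← Complex.ofReal_cos,
      ← Complex.ofReal_sin, e1, e2, e3, e4]
    push_cast
    ring
  rw [h, Complex.arg_mul_cos_add_sin_mul_I hs]
  constructor <;> linarith [Real.pi_pos]

/-- The sawtooth Fourier series. -/
theorem tendsto_sinSum {x : ℝ} (h0 : 0 < x) (h1 : x < 2 * Real.pi) :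
    Tendsto (fun N => sinSum N x) atTop (𝓝 ((Real.pi - x) / 2)) := by
  have hs : Real.sin (x / 2) ≠ 0 :=
    (Real.sin_pos_of_pos_of_lt_pi (by linarith) (by linarith)).ne'
  -- Dirichlet's test gives convergence; the value of the limit is identified afterwards by Abel
  -- summation.
  have hc : CauchySeq fun N => sinSum N x := by
    have := Antitone.cauchySeq_series_mul_of_tendsto_zero_of_bounded
      (f := fun k : ℕ => ((k : ℝ) + 1)⁻¹) (z := fun k : ℕ => Real.sin (((1 + k : ℕ) : ℝ) * x))
      (b := |Real.sin (x / 2)|⁻¹) (fun i j hij => by dsimp only; gcongr)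
      (by simpa using tendsto_one_div_add_atTop_nhds_zero_nat (𝕜 := ℝ))
      (fun n => abs_sum_sin_le hs 1 n)
    simpa only [smul_eq_mul, ← sinSum_eq] using this
  obtain ⟨l, hl⟩ := cauchySeq_tendsto_of_complete hc
  have hl' : Tendsto (fun N => ∑ k ∈ Finset.range N, Real.sin (k * x) / k) atTop (𝓝 l) :=
    (tendsto_add_atTop_iff_nat 1).1 hl
  -- By Abel's theorem the limit is the radial limit of `Im(-log(1 - r e^{jx}))` as `r → 1`, which
  -- is read off from the argument of `1 - e^{jx}`.
  have habel := Real.tendsto_tsum_powerSeries_nhdsWithin_lt hl'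
  have hexp : ∀ᶠ r : ℝ in 𝓝[<] 1, ∑' n : ℕ, Real.sin (n * x) / n * r ^ n =
      (-Complex.log (1 - r * Complex.exp (x * Complex.I))).im := by
    have : Set.Ioo (-1 : ℝ) 1 ∈ 𝓝[<] (1 : ℝ) := Ioo_mem_nhdsLT (by norm_num)
    filter_upwards [this] with r hr
    have hz : ‖(r : ℂ) * Complex.exp (x * Complex.I)‖ < 1 := by
      rw [norm_mul, Complex.norm_exp_ofReal_mul_I, mul_one, Complex.norm_real, Real.norm_eq_abs,
        abs_lt]
      exact hr
    have hS := Complex.hasSum_im (Complex.hasSum_taylorSeries_neg_log hz)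
    rw [← hS.tsum_eq]
    refine tsum_congr fun n => ?_
    rw [mul_pow, ← Complex.exp_nat_mul, ← mul_assoc, ← Complex.ofReal_pow,
      show ((n : ℂ) * x * Complex.I) = ((n * x : ℝ) : ℂ) * Complex.I by push_cast; ring,
      ← Complex.ofReal_natCast, Complex.div_ofReal_im, Complex.im_ofReal_mul, Complex.exp_ofReal_mul_I_im]
    ring
  have hcont : Tendsto (fun r : ℝ => (-Complex.log (1 - r * Complex.exp (x * Complex.I))).im)
      (𝓝[<] 1) (𝓝 ((Real.pi - x) / 2)) := by
    have hmem : 1 - Complex.exp (x * Complex.I) ∈ Complex.slitPlane := by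
      left
      have hc1 : Real.cos x < 1 := by
        have e3 := Real.cos_two_mul (x / 2)
        rw [show 2 * (x / 2) = x by ring, Real.cos_sq'] at e3
        have : 0 < Real.sin (x / 2) ^ 2 := by positivity
        linarith
      simpa [Complex.exp_ofReal_mul_I_re] using hc1
    have hval : (Real.pi - x) / 2 =
        (-Complex.log (1 - ((1 : ℝ) : ℂ) * Complex.exp (x * Complex.I))).im := by
      rw [Complex.ofReal_one, one_mul, Complex.neg_im, Complex.log_im, arg_one_sub_exp h0 h1]; ring
    rw [hval]
    have : ContinuousAt
        (fun r : ℝ => (-Complex.log (1 - r * Complex.exp (x * Complex.I))).im) 1 := by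
      refine Complex.continuous_im.continuousAt.comp (ContinuousAt.neg (ContinuousAt.clog ?_ ?_))
      · fun_prop
      · simpa using hmem
    exact this.tendsto.mono_left nhdsWithin_le_nhds
  have := tendsto_nhds_unique (habel.congr' hexp) hcont
  rwa [this] at hl

theorem sinSum_neg (N : ℕ) (x : ℝ) : sinSum N (-x) = -sinSum N x := by
  simp [sinSum, neg_div]

theorem tendsto_sinSum_neg {x : ℝ} (h0 : x < 0) (h1 : -(2 * Real.pi) < x) :
    Tendsto (fun N => sinSum N x) atTop (𝓝 (-(Real.pi + x) / 2)) := by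
  have := (tendsto_sinSum (x := -x) (by linarith) (by linarith)).neg
  simp only [sinSum_neg, neg_neg] at this
  convert this using 2
  ring

/-- The endpoints `x = ±2π`, where all terms vanish, are needed because a frequency and an angle may
be `π` and `-π`. -/
theorem exists_tendsto_sinSum {x : ℝ} (h : |x| ≤ 2 * Real.pi) :
    ∃ l, Tendsto (fun N => sinSum N x) atTop (𝓝 l) := by
  obtain ⟨h1, h2⟩ := abs_le.1 h
  rcases h1.eq_or_lt with h1 | h1
  · refine ⟨0, tendsto_const_nhds.congr fun N => ?_⟩
    symm
    refine Finset.sum_eq_zero fun k _ => ?_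
    have : (k : ℝ) * x = -((2 * k : ℕ) * Real.pi) := by rw [← h1]; push_cast; ring
    rw [this, Real.sin_neg, Real.sin_nat_mul_pi]; simp
  rcases h2.eq_or_lt with h2 | h2
  · refine ⟨0, tendsto_const_nhds.congr fun N => ?_⟩
    symm
    refine Finset.sum_eq_zero fun k _ => ?_
    have : (k : ℝ) * x = ((2 * k : ℕ) * Real.pi) := by rw [h2]; push_cast; ring
    rw [this, Real.sin_nat_mul_pi]; simp
  rcases lt_trichotomy x 0 with h0 | h0 | h0
  · exact ⟨_, tendsto_sinSum_neg h0 h1⟩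
  · exact ⟨0, by simp [h0, sinSum]⟩
  · exact ⟨_, tendsto_sinSum h0 h2⟩

/-! ### Fourier partial sums of arc indicators -/

/-- The trigonometric polynomial `∑_{|k| ≤ N} χ_k(ϑ₁, ϑ₂) e^{jkt}`. -/
def chiPoly (t₁ t₂ : ℝ) (N : ℕ) (t : ℝ) : ℂ :=
  ∑ k ∈ Finset.Icc (-(N : ℤ)) (N : ℤ), chi k t₁ t₂ * Complex.exp (Complex.I * k * t)

theorem sum_Icc_neg_succ {M : Type*} [AddCommMonoid M] (f : ℤ → M) (N : ℕ) :
    ∑ k ∈ Finset.Icc (-((N + 1 : ℕ) : ℤ)) ((N + 1 : ℕ) : ℤ), f k =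
      (∑ k ∈ Finset.Icc (-(N : ℤ)) (N : ℤ), f k) + (f (N + 1 : ℕ) + f (-(N + 1 : ℕ))) := by
  have : Finset.Icc (-((N + 1 : ℕ) : ℤ)) ((N + 1 : ℕ) : ℤ) =
      insert (((N + 1 : ℕ) : ℤ)) (insert (-((N + 1 : ℕ) : ℤ)) (Finset.Icc (-(N : ℤ)) (N : ℤ))) := by
    ext k
    simp only [Finset.mem_Icc, Finset.mem_insert]
    push_cast
    omega
  rw [this, Finset.sum_insert, Finset.sum_insert]
  · abel
  · simp
  · simp only [Finset.mem_insert, Finset.mem_Icc]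
    push_cast
    omega

theorem chi_mul_exp_add {k : ℕ} (hk : k ≠ 0) (t₁ t₂ t : ℝ) :
    chi k t₁ t₂ * Complex.exp (Complex.I * (k : ℤ) * t) +
      chi (-k : ℤ) t₁ t₂ * Complex.exp (Complex.I * (-k : ℤ) * t) =
      (((Real.sin (k * (t - t₁)) / k - Real.sin (k * (t - t₂)) / k) / Real.pi : ℝ) : ℂ) := by
  have hk' : (k : ℂ) ≠ 0 := by exact_mod_cast hk
  have hpi : (Real.pi : ℂ) ≠ 0 := by exact_mod_cast Real.pi_ne_zero
  have e : ∀ s : ℝ, ((Real.sin (k * (t - s)) : ℝ) : ℂ) =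
      (Complex.exp (-(k * (t - s)) * Complex.I) - Complex.exp (k * (t - s) * Complex.I)) *
        Complex.I / 2 := by
    intro s
    rw [Complex.ofReal_sin, Complex.sin]
    push_cast
    ring
  have f1 : ∀ s : ℝ, Complex.exp (k * (t - s) * Complex.I) =
      Complex.exp (-Complex.I * s * k) * Complex.exp (Complex.I * k * t) := by
    intro s; rw [← Complex.exp_add]; congr 1; ring
  have f2 : ∀ s : ℝ, Complex.exp (-(k * (t - s)) * Complex.I) =
      Complex.exp (Complex.I * s * k) * Complex.exp (-(Complex.I * k * t)) := by
    intro s; rw [← Complex.exp_add]; congr 1; ring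
  push_cast [chi]
  rw [if_neg (by exact_mod_cast hk), if_neg (by simpa using hk)]
  push_cast at e
  rw [e t₁, e t₂, f1, f1, f2, f2]
  simp only [mul_neg, neg_mul, neg_neg]
  generalize Complex.exp (-(Complex.I * t₁ * k)) = a₁
  generalize Complex.exp (-(Complex.I * t₂ * k)) = a₂
  generalize Complex.exp (Complex.I * t₁ * k) = b₁
  generalize Complex.exp (Complex.I * t₂ * k) = b₂
  generalize Complex.exp (Complex.I * k * t) = c
  generalize Complex.exp (-(Complex.I * k * t)) = d
  field_simp
  linear_combination ((a₁ - a₂) * c + (b₂ - b₁) * d) * Complex.I_sq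

/-- Pairing `k` with `-k` leaves only real sine terms, so bounds and limits for `sinSum` transfer
directly. -/
theorem chiPoly_eq (t₁ t₂ : ℝ) (N : ℕ) (t : ℝ) :
    chiPoly t₁ t₂ N t =
      (((t₂ - t₁) / (2 * Real.pi) + (sinSum N (t - t₁) - sinSum N (t - t₂)) / Real.pi : ℝ) : ℂ) := by
  induction N with
  | zero => simp [chiPoly, chi, sinSum]
  | succ N ih =>
    rw [chiPoly, sum_Icc_neg_succ, ← chiPoly, ih]
    have := chi_mul_exp_add (Nat.succ_ne_zero N) t₁ t₂ t
    rw [Nat.succ_eq_add_one] at this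
    simp only [Int.cast_natCast] at this ⊢
    rw [this, ← Complex.ofReal_add]
    congr 1
    have hsucc : ∀ x, sinSum (N + 1) x = sinSum N x + Real.sin ((N + 1 : ℕ) * x) / (N + 1 : ℕ) :=
      fun x => Finset.sum_range_succ _ _
    rw [hsucc, hsucc]
    ring

theorem norm_chiPoly_le (t₁ t₂ : ℝ) (N : ℕ) (t : ℝ) :
    ‖chiPoly t₁ t₂ N t‖ ≤ |t₂ - t₁| / (2 * Real.pi) + 6 / Real.pi := by
  rw [chiPoly_eq, Complex.norm_real, Real.norm_eq_abs]
  refine (abs_add_le _ _).trans ?_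
  rw [abs_div, abs_div, abs_of_pos Real.pi_pos, abs_of_pos (by positivity : 0 < 2 * Real.pi)]
  gcongr
  refine (abs_sub _ _).trans ?_
  linarith [abs_sinSum_le N (t - t₁), abs_sinSum_le N (t - t₂)]

theorem exists_tendsto_chiPoly {t₁ t₂ t : ℝ} (h₁ : t₁ ∈ Set.Icc (-Real.pi) Real.pi)
    (h₂ : t₂ ∈ Set.Icc (-Real.pi) Real.pi) (ht : t ∈ Set.Icc (-Real.pi) Real.pi) :
    ∃ l, Tendsto (fun N => chiPoly t₁ t₂ N t) atTop (𝓝 l) := by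
  obtain ⟨l₁, hl₁⟩ := exists_tendsto_sinSum (x := t - t₁)
    (abs_le.2 ⟨by linarith [h₁.2, ht.1], by linarith [h₁.1, ht.2]⟩)
  obtain ⟨l₂, hl₂⟩ := exists_tendsto_sinSum (x := t - t₂)
    (abs_le.2 ⟨by linarith [h₂.2, ht.1], by linarith [h₂.1, ht.2]⟩)
  simp only [chiPoly_eq]
  exact ⟨_, (Complex.continuous_ofReal.tendsto _).comp
    (((hl₁.sub hl₂).div_const _).const_add _)⟩

/-- Both sawtooth limits lie on the same linear branch, so their difference cancels the constant
term. The distances must stay strictly below `2π`, where the sawtooth jumps. -/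
theorem tendsto_chiPoly_zero_of_lt {t₁ t₂ t : ℝ} (h₁ : 0 < t - t₁) (h₁' : t - t₁ < 2 * Real.pi)
    (h₂ : 0 < t - t₂) (h₂' : t - t₂ < 2 * Real.pi) :
    Tendsto (fun N => chiPoly t₁ t₂ N t) atTop (𝓝 0) := by
  simp only [chiPoly_eq]
  have := (Complex.continuous_ofReal.tendsto _).comp
    ((((tendsto_sinSum h₁ h₁').sub (tendsto_sinSum h₂ h₂')).div_const Real.pi).const_add
      ((t₂ - t₁) / (2 * Real.pi)))
  have e : (t₂ - t₁) / (2 * Real.pi) + ((Real.pi - (t - t₁)) / 2 - (Real.pi - (t - t₂)) / 2) / Real.pi = 0 := by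
    field_simp
    ring
  rwa [e, Complex.ofReal_zero] at this

theorem tendsto_chiPoly_zero_of_gt {t₁ t₂ t : ℝ} (h₁ : t - t₁ < 0) (h₁' : -(2 * Real.pi) < t - t₁)
    (h₂ : t - t₂ < 0) (h₂' : -(2 * Real.pi) < t - t₂) :
    Tendsto (fun N => chiPoly t₁ t₂ N t) atTop (𝓝 0) := by
  simp only [chiPoly_eq]
  have := (Complex.continuous_ofReal.tendsto _).comp
    ((((tendsto_sinSum_neg h₁ h₁').sub (tendsto_sinSum_neg h₂ h₂')).div_const Real.pi).const_add
      ((t₂ - t₁) / (2 * Real.pi)))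
  have e : (t₂ - t₁) / (2 * Real.pi) + (-(Real.pi + (t - t₁)) / 2 - -(Real.pi + (t - t₂)) / 2) / Real.pi = 0 := by
    field_simp
    ring
  rwa [e, Complex.ofReal_zero] at this

/-! ### Herglotz' theorem for stationary sequences -/

/-- A sequence in a Hilbert space is stationary if its Gram matrix is invariant under shifts. -/
def IsStationarySeq {H : Type*} [NormedAddCommGroup H] [InnerProductSpace ℂ H] (w : ℤ → H) : Prop :=
  ∀ k l n : ℤ, inner ℂ (w (k + n)) (w (l + n)) = inner ℂ (w k) (w l)

section Herglotz

variable {H : Type*} [NormedAddCommGroup H] [InnerProductSpace ℂ H] {w : ℤ → H}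

theorem IsStationarySeq.inner_eq (hw : IsStationarySeq w) (k l : ℤ) :
    inner ℂ (w k) (w l) = inner ℂ (w 0) (w (l - k)) := by
  have := hw 0 (l - k) k
  simpa using this


theorem integral_fourier_haarAddCircle [Fact (0 < 2 * Real.pi)] (j : ℤ) :
    ∫ x, fourier j x ∂(AddCircle.haarAddCircle (T := 2 * Real.pi)) = if j = 0 then 1 else 0 := by
  have := congrFun (fourierCoeff_fourier (T := 2 * Real.pi) j) 0
  simpa [fourierCoeff, Pi.single_apply, eq_comm] using this

/-- The Hilbert space valued trigonometric polynomial whose squared norm is a Fejér-type density. -/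
def trigSum (w : ℤ → H) (n : ℕ) (x : AddCircle (2 * Real.pi)) : H :=
  ∑ k ∈ Finset.Ico (0 : ℤ) (n + 1), fourier (-k) x • w k

theorem continuous_trigSum (w : ℤ → H) (n : ℕ) : Continuous (trigSum w n) := by
  unfold trigSum
  fun_prop

/-- The number of pairs in `{0, …, n}²` with difference `m`. -/
def pairCount (n : ℕ) (m : ℤ) : ℕ :=
  (Finset.Ico (max 0 (-m)) (min (n + 1) (n + 1 - m) : ℤ)).card

theorem tendsto_pairCount (m : ℤ) :
    Tendsto (fun n : ℕ => (pairCount n m : ℝ) / (n + 1)) atTop (𝓝 1) := by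
  have h1 : ∀ n : ℕ, (1 : ℝ) - |m| * (1 / ((n : ℝ) + 1)) ≤ (pairCount n m : ℝ) / (n + 1) := by
    intro n
    have : (n + 1 : ℤ) - |m| ≤ pairCount n m := by
      rw [pairCount, Int.card_Ico]; grind
    have h : ((n : ℝ) + 1) - |(m : ℝ)| ≤ pairCount n m := by exact_mod_cast this
    rw [le_div_iff₀ (by positivity)]
    field_simp
    push_cast at *
    linarith
  have h2 : ∀ n : ℕ, (pairCount n m : ℝ) / (n + 1) ≤ 1 := by
    intro n
    have : (pairCount n m : ℤ) ≤ n + 1 := by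
      rw [pairCount, Int.card_Ico]; grind
    rw [div_le_one (by positivity)]
    exact_mod_cast this
  have h3 : Tendsto (fun n : ℕ => (1 : ℝ) - |m| * (1 / ((n : ℝ) + 1))) atTop (𝓝 1) := by
    simpa using (tendsto_one_div_add_atTop_nhds_zero_nat (𝕜 := ℝ)).const_mul (|m| : ℝ)
      |>.const_sub 1
  exact tendsto_of_tendsto_of_tendsto_of_le_of_le h3 tendsto_const_nhds h1 h2

theorem sum_sum_ite_eq (n : ℕ) (m : ℤ) (c : ℂ) :
    ∑ k ∈ Finset.Ico (0 : ℤ) (n + 1), ∑ l ∈ Finset.Ico (0 : ℤ) (n + 1),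
      (if m + (k - l) = 0 then c else 0) = pairCount n m * c := by
  have h : ∀ k ∈ Finset.Ico (0 : ℤ) (n + 1), ∑ l ∈ Finset.Ico (0 : ℤ) (n + 1),
      (if m + (k - l) = 0 then c else 0) = if m + k ∈ Finset.Ico (0 : ℤ) (n + 1) then c else 0 := by
    intro k _
    rw [← Finset.sum_ite_eq (Finset.Ico (0 : ℤ) (n + 1)) (m + k) (fun _ => c)]
    refine Finset.sum_congr rfl fun l _ => ?_
    congr 1
    rw [← add_sub_assoc, sub_eq_zero]
  rw [Finset.sum_congr rfl h, ← Finset.sum_filter, Finset.sum_const, nsmul_eq_mul]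
  congr 3
  ext k
  simp only [Finset.mem_filter, Finset.mem_Ico, lt_min_iff, max_le_iff]
  omega

/-- After expanding the square, stationarity makes the pair `(k, l)` contribute a coefficient
depending only on `l - k`; orthogonality of characters keeps the pairs with `l - k = m`, whose
number over `n + 1` is the Fejér weight. -/
theorem integral_fourier_mul_normSq_trigSum [Fact (0 < 2 * Real.pi)] (hw : IsStationarySeq w) (n : ℕ) (m : ℤ) :
    ∫ x, ((‖trigSum w n x‖ ^ 2 / (n + 1) : ℝ) : ℂ) * fourier m x
      ∂(AddCircle.haarAddCircle (T := 2 * Real.pi)) =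
      ((pairCount n m : ℝ) / (n + 1) : ℝ) * inner ℂ (w 0) (w m) := by
  have key : ∀ x, ((‖trigSum w n x‖ ^ 2 / (n + 1) : ℝ) : ℂ) * fourier m x =
      ((n : ℂ) + 1)⁻¹ * ∑ k ∈ Finset.Ico (0 : ℤ) (n + 1), ∑ l ∈ Finset.Ico (0 : ℤ) (n + 1),
        inner ℂ (w 0) (w (l - k)) * fourier (m + (k - l)) x := by
    intro x
    have h : ((‖trigSum w n x‖ ^ 2 : ℝ) : ℂ) = ∑ k ∈ Finset.Ico (0 : ℤ) (n + 1),
        ∑ l ∈ Finset.Ico (0 : ℤ) (n + 1), inner ℂ (w 0) (w (l - k)) * fourier (k - l) x := by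
      have h1 := inner_self_eq_norm_sq_to_K (𝕜 := ℂ) (trigSum w n x)
      push_cast
      refine h1.symm.trans ?_
      rw [trigSum, sum_inner]
      refine Finset.sum_congr rfl fun k _ => ?_
      rw [inner_sum]
      refine Finset.sum_congr rfl fun l _ => ?_
      rw [inner_smul_left, inner_smul_right, hw.inner_eq, ← fourier_neg, neg_neg, ← mul_assoc,
        ← fourier_add, mul_comm, sub_eq_add_neg k l]
    rw [Complex.ofReal_div, h, div_eq_inv_mul, mul_assoc, Finset.sum_mul]
    push_cast
    congr 1
    refine Finset.sum_congr rfl fun k _ => ?_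
    rw [Finset.sum_mul]
    refine Finset.sum_congr rfl fun l _ => ?_
    rw [fourier_add (m := m)]
    ring
  have hint : ∀ j : ℤ, Integrable (fun x => fourier j x)
      (AddCircle.haarAddCircle (T := 2 * Real.pi)) := fun j =>
    (map_continuous (fourier j)).integrable_of_hasCompactSupport
      (HasCompactSupport.of_compactSpace _)
  simp_rw [key]
  rw [integral_const_mul, integral_finsetSum]
  · have : ∀ k ∈ Finset.Ico (0 : ℤ) (n + 1), ∫ x, ∑ l ∈ Finset.Ico (0 : ℤ) (n + 1),
        inner ℂ (w 0) (w (l - k)) * fourier (m + (k - l)) x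
        ∂(AddCircle.haarAddCircle (T := 2 * Real.pi)) =
        ∑ l ∈ Finset.Ico (0 : ℤ) (n + 1), if m + (k - l) = 0 then inner ℂ (w 0) (w m) else 0 := by
      intro k _
      rw [integral_finsetSum _ fun l _ => (hint _).const_mul _]
      refine Finset.sum_congr rfl fun l _ => ?_
      rw [integral_const_mul, integral_fourier_haarAddCircle]
      split_ifs with h
      · rw [show l - k = m by omega, mul_one]
      · rw [mul_zero]
    rw [Finset.sum_congr rfl this, sum_sum_ite_eq]
    push_cast
    ring
  · intro k _
    exact integrable_finsetSum _ fun l _ => (hint _).const_mul _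

/-- **Herglotz' theorem** on the circle. -/
theorem IsStationarySeq.exists_measure_addCircle [Fact (0 < 2 * Real.pi)]
    (hw : IsStationarySeq w) :
    ∃ ν : Measure (AddCircle (2 * Real.pi)), IsFiniteMeasure ν ∧
      ∀ m : ℤ, inner ℂ (w 0) (w m) = ∫ x, fourier m x ∂ν := by
  let p : ℕ → AddCircle (2 * Real.pi) → ℝ := fun n x => ‖trigSum w n x‖ ^ 2 / (n + 1)
  have hp : ∀ n, Continuous (p n) := fun n => by
    have := continuous_trigSum w n
    fun_prop
  have hp0 : ∀ n x, 0 ≤ p n x := fun n x => by positivity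
  let M : ℕ → Measure (AddCircle (2 * Real.pi)) := fun n =>
    AddCircle.haarAddCircle.withDensity fun x => ENNReal.ofReal (p n x)
  have hM : ∀ n, IsFiniteMeasure (M n) := fun n =>
    isFiniteMeasure_withDensity_ofReal
      ((hp n).integrable_of_hasCompactSupport (HasCompactSupport.of_compactSpace _)).2
  have hMint : ∀ n m, ∫ x, fourier m x ∂(M n) =
      ((pairCount n m : ℝ) / (n + 1) : ℝ) * inner ℂ (w 0) (w m) := by
    intro n m
    rw [← integral_fourier_mul_normSq_trigSum hw, integral_withDensity_eq_integral_toReal_smul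
      (hp n).measurable.ennreal_ofReal (by simp)]
    refine integral_congr_ae (.of_forall fun x => ?_)
    simp only [ENNReal.toReal_ofReal (hp0 n x), Complex.real_smul, p]
  let μ : ℕ → FiniteMeasure (AddCircle (2 * Real.pi)) := fun n => ⟨M n, hM n⟩
  let C : NNReal := ‖w 0‖₊ ^ 2
  have hmass : ∀ n, (μ n).mass ≤ C := by
    intro n
    have h1 := hMint n 0
    have hcount : pairCount n 0 = n + 1 := by
      simp only [pairCount, Int.card_Ico, neg_zero, max_self, sub_zero, min_self]
      omega
    simp only [fourier_zero, integral_const, hcount] at h1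
    have h2 : ((M n).real Set.univ : ℂ) = ((‖w 0‖ ^ 2 : ℝ) : ℂ) := by
      have h3 := inner_self_eq_norm_sq_to_K (𝕜 := ℂ) (w 0)
      have h4 : ((n : ℂ) + 1) ≠ 0 := by exact_mod_cast Nat.succ_ne_zero n
      push_cast at h1 ⊢
      rw [div_self h4, one_mul, h3] at h1
      simpa using h1
    have h5 : (M n).real Set.univ = ‖w 0‖ ^ 2 := by exact_mod_cast h2
    rw [← NNReal.coe_le_coe]
    exact h5.le
  -- The densities all have mass `‖w 0‖²`, and measures of bounded mass on the compact circle form a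
  -- weakly compact set; an ultrafilter limit replaces the choice of a subsequence.
  obtain ⟨ν, -, hν⟩ := (isCompact_setOfPred_finiteMeasure_le_of_compactSpace
    (AddCircle (2 * Real.pi)) C).ultrafilter_le_nhds ((hyperfilter ℕ).map μ)
    (by
      rw [Filter.le_principal_iff]
      exact Filter.Eventually.of_forall (f := (hyperfilter ℕ : Filter ℕ)) hmass)
  have hlim : Tendsto μ (hyperfilter ℕ) (𝓝 ν) := hν
  refine ⟨ν, inferInstance, fun m => ?_⟩
  have h1 := (FiniteMeasure.tendsto_iff_forall_integral_rclike_tendsto ℂ).1 hlim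
    (BoundedContinuousFunction.mkOfCompact (fourier m))
  have h2 : Tendsto (fun n => ∫ x, fourier m x ∂(M n)) (hyperfilter ℕ)
      (𝓝 (inner ℂ (w 0) (w m))) := by
    simp_rw [hMint]
    have := ((Complex.continuous_ofReal.tendsto _).comp (tendsto_pairCount m)).mul_const
      (inner ℂ (w 0) (w m))
    rw [Complex.ofReal_one, one_mul] at this
    exact this.mono_left Nat.hyperfilter_le_atTop
  exact tendsto_nhds_unique h2 h1

end Herglotz

/-- **Herglotz' theorem**: the Gram matrix of a stationary sequence is given by the Fourier
coefficients of a finite measure on `(-π, π]`. -/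
theorem IsStationarySeq.exists_measure {H : Type*} [NormedAddCommGroup H] [InnerProductSpace ℂ H]
    {w : ℤ → H} (hw : IsStationarySeq w) :
    ∃ ν : Measure ℝ, IsFiniteMeasure ν ∧ (∀ᵐ t ∂ν, t ∈ Set.Ioc (-Real.pi) Real.pi) ∧
      ∀ k l : ℤ, inner ℂ (w k) (w l) = ∫ t : ℝ, Complex.exp (Complex.I * (l - k : ℤ) * t) ∂ν := by
  have : Fact (0 < 2 * Real.pi) := ⟨Real.two_pi_pos⟩
  obtain ⟨ν, hν, hint⟩ := hw.exists_measure_addCircle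
  let e : AddCircle (2 * Real.pi) → ℝ := fun x =>
    (AddCircle.measurableEquivIoc (2 * Real.pi) (-Real.pi) x : ℝ)
  have he : Measurable e :=
    measurable_subtype_coe.comp (AddCircle.measurableEquivIoc (2 * Real.pi) (-Real.pi)).measurable
  refine ⟨ν.map e, inferInstance, ?_, fun k l => ?_⟩
  · refine (ae_map_iff he.aemeasurable measurableSet_Ioc).2 ?_
    refine .of_forall fun x => ?_
    have := (AddCircle.measurableEquivIoc (2 * Real.pi) (-Real.pi) x).2
    exact ⟨this.1, this.2.trans (by linarith)⟩
  · rw [hw.inner_eq, hint, integral_map he.aemeasurable (by fun_prop)]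
    refine integral_congr_ae (.of_forall fun x => ?_)
    have hx : ((e x : ℝ) : AddCircle (2 * Real.pi)) = x := AddCircle.coe_equivIoc
    dsimp only
    conv_lhs => rw [← hx]
    rw [fourier_coe_apply]
    congr 1
    push_cast
    have : (Real.pi : ℂ) ≠ 0 := by exact_mod_cast Real.pi_ne_zero
    field_simp

/-! ### Wiener's lemma: detecting atoms by Cesàro means -/

/-- The Cesàro means `N⁻¹ ∑_{n < N} e^{-jnτ} c_n`, which detect an atom at the frequency `τ`. -/
def cesaroMean (c : ℤ → ℂ) (τ : ℝ) (N : ℕ) : ℂ :=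
  (N : ℂ)⁻¹ * ∑ n ∈ Finset.range N, Complex.exp (-Complex.I * n * τ) * c n

/-- The normalized one-sided Dirichlet kernel. -/
def meanKernel (N : ℕ) (x : ℝ) : ℂ :=
  (N : ℂ)⁻¹ * ∑ n ∈ Finset.range N, Complex.exp (Complex.I * n * x)

theorem norm_exp_I_mul_nat_mul (n : ℕ) (x : ℝ) : ‖Complex.exp (Complex.I * n * x)‖ = 1 := by
  rw [show Complex.I * n * x = ((n * x : ℝ) : ℂ) * Complex.I by push_cast; ring,
    Complex.norm_exp_ofReal_mul_I]

theorem norm_exp_I_mul_int_mul (n : ℤ) (x : ℝ) : ‖Complex.exp (Complex.I * n * x)‖ = 1 := by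
  rw [show Complex.I * n * x = ((n * x : ℝ) : ℂ) * Complex.I by push_cast; ring,
    Complex.norm_exp_ofReal_mul_I]

theorem norm_meanKernel_le (N : ℕ) (x : ℝ) : ‖meanKernel N x‖ ≤ 1 := by
  rw [meanKernel, norm_mul, norm_inv, Complex.norm_natCast]
  have : ‖∑ n ∈ Finset.range N, Complex.exp (Complex.I * n * x)‖ ≤ N := by
    refine (norm_sum_le _ _).trans ?_
    simp [norm_exp_I_mul_nat_mul]
  rcases N.eq_zero_or_pos with rfl | hN
  · simp
  · rw [inv_mul_le_iff₀ (by exact_mod_cast hN), mul_one]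
    exact this

theorem continuous_meanKernel (N : ℕ) : Continuous (meanKernel N) := by
  unfold meanKernel
  fun_prop

theorem exp_I_mul_sub_ne_one {t τ : ℝ} (ht : t ∈ Set.Ioc (-Real.pi) Real.pi)
    (hτ : τ ∈ Set.Ioc (-Real.pi) Real.pi) (h : t ≠ τ) :
    Complex.exp (Complex.I * (t - τ : ℝ)) ≠ 1 := by
  intro h1
  obtain ⟨n, hn⟩ := Complex.exp_eq_one_iff.1 h1
  have h2 : t - τ = n * (2 * Real.pi) := by
    have : Complex.I * ((t - τ : ℝ) : ℂ) = Complex.I * ((n * (2 * Real.pi) : ℝ) : ℂ) := by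
      rw [hn]; push_cast; ring
    exact_mod_cast mul_left_cancel₀ Complex.I_ne_zero this
  have hpi := Real.pi_pos
  have h3 : (n : ℝ) < 1 := by
    by_contra hc
    push Not at hc
    nlinarith [ht.2, hτ.1]
  have h4 : (-1 : ℝ) < n := by
    by_contra hc
    push Not at hc
    nlinarith [ht.1, hτ.2]
  have h5 : n = 0 := by
    have h3' : n < 1 := by exact_mod_cast h3
    have h4' : -1 < n := by exact_mod_cast h4
    omega
  rw [h5] at h2
  simp only [Int.cast_zero, zero_mul] at h2
  exact h (sub_eq_zero.1 h2)

/-- At `t = τ` every summand is `1`. Elsewhere the geometric sum stays below `2/|z - 1|`, and the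
factor `1/N` sends it to zero. -/
theorem tendsto_meanKernel {t τ : ℝ} (ht : t ∈ Set.Ioc (-Real.pi) Real.pi)
    (hτ : τ ∈ Set.Ioc (-Real.pi) Real.pi) :
    Tendsto (fun N => meanKernel N (t - τ)) atTop
      (𝓝 (({τ} : Set ℝ).indicator (fun _ => (1 : ℂ)) t)) := by
  by_cases h : t = τ
  · subst h
    refine tendsto_const_nhds.congr' ?_
    filter_upwards [eventually_ne_atTop 0] with N hN
    have : (N : ℂ) ≠ 0 := by exact_mod_cast hN
    simp [meanKernel, this]
  · rw [Set.indicator_of_notMem (by simpa using h)]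
    have hz := exp_I_mul_sub_ne_one ht hτ h
    set z := Complex.exp (Complex.I * (t - τ : ℝ)) with hz_def
    have hz' : 0 < ‖z - 1‖ := norm_pos_iff.2 (sub_ne_zero.2 hz)
    have hnorm : ‖z‖ = 1 := by
      have := norm_exp_I_mul_nat_mul 1 (t - τ)
      rwa [Nat.cast_one, mul_one] at this
    have hb : ∀ N : ℕ, ‖meanKernel N (t - τ)‖ ≤ (N : ℝ)⁻¹ * (2 / ‖z - 1‖) := by
      intro N
      have : ∑ n ∈ Finset.range N, Complex.exp (Complex.I * n * (t - τ : ℝ)) =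
          (z ^ N - 1) / (z - 1) := by
        rw [← geom_sum_eq hz]
        refine Finset.sum_congr rfl fun n _ => ?_
        rw [hz_def, ← Complex.exp_nat_mul]
        congr 1; ring
      rw [meanKernel, this, norm_mul, norm_inv, Complex.norm_natCast, norm_div]
      gcongr
      refine (norm_sub_le _ _).trans ?_
      rw [norm_pow, hnorm, one_pow, norm_one]
      norm_num
    refine squeeze_zero_norm hb ?_
    simpa using (tendsto_inv_atTop_nhds_zero_nat (𝕜 := ℝ)).mul_const (2 / ‖z - 1‖)

theorem cesaroMean_integral {ν : Measure ℝ} [IsFiniteMeasure ν] (τ : ℝ) (N : ℕ) :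
    cesaroMean (fun n => ∫ t : ℝ, Complex.exp (Complex.I * n * t) ∂ν) τ N =
      ∫ t, meanKernel N (t - τ) ∂ν := by
  simp only [cesaroMean, meanKernel]
  rw [integral_const_mul, integral_finsetSum]
  · congr 1
    refine Finset.sum_congr rfl fun n _ => ?_
    rw [← integral_const_mul]
    refine integral_congr_ae (.of_forall fun t => ?_)
    dsimp only
    rw [← Complex.exp_add]
    congr 1
    push_cast
    ring
  · intro n _
    refine Integrable.of_bound (C := 1) (by fun_prop) (.of_forall fun t => ?_)
    exact (norm_exp_I_mul_nat_mul n (t - τ)).le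

/-- **Wiener's lemma**: a measure whose Fourier coefficients have vanishing Cesàro means at the
frequency `τ` has no atom there. -/
theorem measure_singleton_eq_zero_of_cesaroMean {ν : Measure ℝ} [IsFiniteMeasure ν]
    (hν : ∀ᵐ t ∂ν, t ∈ Set.Ioc (-Real.pi) Real.pi) {τ : ℝ}
    (hτ : τ ∈ Set.Ioc (-Real.pi) Real.pi)
    (h : Tendsto (cesaroMean (fun n => ∫ t : ℝ, Complex.exp (Complex.I * n * t) ∂ν) τ)
      atTop (𝓝 0)) : ν {τ} = 0 := by
  have h1 : Tendsto (fun N => ∫ t, meanKernel N (t - τ) ∂ν) atTop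
      (𝓝 (∫ t, ({τ} : Set ℝ).indicator (fun _ => (1 : ℂ)) t ∂ν)) := by
    refine tendsto_integral_of_dominated_convergence (fun _ => 1) (fun N => ?_)
      (integrable_const _) (fun N => .of_forall fun t => norm_meanKernel_le _ _) ?_
    · exact ((continuous_meanKernel N).comp (by fun_prop)).aestronglyMeasurable
    · filter_upwards [hν] with t ht using tendsto_meanKernel ht hτ
  have h2 := tendsto_nhds_unique (h.congr fun N => cesaroMean_integral τ N) h1
  rw [integral_indicator_const _ (measurableSet_singleton τ), Complex.real_smul, mul_one] at h2
  have h3 : ν.real {τ} = 0 := by exact_mod_cast h2.symm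
  exact (measureReal_eq_zero_iff).1 h3

/-! ### Convergence and orthogonality of the partial sums in Hilbert space -/

section Hilbert

variable {H : Type*} [NormedAddCommGroup H] [InnerProductSpace ℂ H]

/-- The partial sums `∑_{k=-N}^{N} χ_k(ϑ₁, ϑ₂) w_k` of a sequence in a Hilbert space. -/
def chiSum (w : ℤ → H) (t₁ t₂ : ℝ) (N : ℕ) : H :=
  ∑ k ∈ Finset.Icc (-(N : ℤ)) (N : ℤ), chi k t₁ t₂ • w k

theorem continuous_chiPoly (t₁ t₂ : ℝ) (N : ℕ) : Continuous (chiPoly t₁ t₂ N) := by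
  unfold chiPoly
  fun_prop

theorem inner_chiSum_eq_integral {w : ℤ → H} {ν : Measure ℝ} [IsFiniteMeasure ν]
    (hint : ∀ k l : ℤ,
      inner ℂ (w k) (w l) = ∫ t : ℝ, Complex.exp (Complex.I * (l - k : ℤ) * t) ∂ν)
    (t₁ t₂ t₃ t₄ : ℝ) (N M : ℕ) :
    inner ℂ (chiSum w t₁ t₂ N) (chiSum w t₃ t₄ M) =
      ∫ t, starRingEnd ℂ (chiPoly t₁ t₂ N t) * chiPoly t₃ t₄ M t ∂ν := by
  have hexp : ∀ n : ℤ, Integrable (fun t : ℝ => Complex.exp (Complex.I * n * t)) ν := fun n =>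
    Integrable.of_bound (C := 1) (by fun_prop)
      (.of_forall fun t => (norm_exp_I_mul_int_mul n t).le)
  have key : ∀ t : ℝ, starRingEnd ℂ (chiPoly t₁ t₂ N t) * chiPoly t₃ t₄ M t =
      ∑ k ∈ Finset.Icc (-(N : ℤ)) (N : ℤ), ∑ l ∈ Finset.Icc (-(M : ℤ)) (M : ℤ),
        starRingEnd ℂ (chi k t₁ t₂) * chi l t₃ t₄ *
          Complex.exp (Complex.I * (l - k : ℤ) * t) := by
    intro t
    rw [chiPoly, chiPoly, map_sum, Finset.sum_mul_sum]
    refine Finset.sum_congr rfl fun k _ => Finset.sum_congr rfl fun l _ => ?_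
    rw [map_mul, ← Complex.exp_conj]
    simp only [map_mul, Complex.conj_I, Complex.conj_ofReal, map_intCast]
    rw [show Complex.I * ((l - k : ℤ) : ℂ) * t = -Complex.I * k * t + Complex.I * l * t by
      push_cast; ring, Complex.exp_add]
    ring
  simp_rw [key]
  rw [integral_finsetSum _ fun k _ => integrable_finsetSum _ fun l _ => (hexp _).const_mul _,
    chiSum, sum_inner]
  refine Finset.sum_congr rfl fun k _ => ?_
  rw [integral_finsetSum _ fun l _ => (hexp _).const_mul _, chiSum, inner_sum]
  refine Finset.sum_congr rfl fun l _ => ?_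
  rw [integral_const_mul, inner_smul_left, inner_smul_right, hint, mul_assoc]

/-- Dominated convergence with a constant bound. The limit is taken jointly in both indices, as the
Cauchy property requires. -/
theorem tendsto_inner_chiSum {w : ℤ → H} {ν : Measure ℝ} [IsFiniteMeasure ν]
    (hν : ∀ᵐ t ∂ν, t ∈ Set.Ioc (-Real.pi) Real.pi)
    (hint : ∀ k l : ℤ,
      inner ℂ (w k) (w l) = ∫ t : ℝ, Complex.exp (Complex.I * (l - k : ℤ) * t) ∂ν)
    {t₁ t₂ t₃ t₄ : ℝ} {G G' : ℝ → ℂ}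
    (hG : ∀ t ∈ Set.Ioc (-Real.pi) Real.pi,
      Tendsto (fun N => chiPoly t₁ t₂ N t) atTop (𝓝 (G t)))
    (hG' : ∀ t ∈ Set.Ioc (-Real.pi) Real.pi,
      Tendsto (fun N => chiPoly t₃ t₄ N t) atTop (𝓝 (G' t))) :
    Tendsto (fun p : ℕ × ℕ => inner ℂ (chiSum w t₁ t₂ p.1) (chiSum w t₃ t₄ p.2)) atTop
      (𝓝 (∫ t, starRingEnd ℂ (G t) * G' t ∂ν)) := by
  simp_rw [inner_chiSum_eq_integral hint]
  refine tendsto_integral_filter_of_norm_le_const (.of_forall fun p => ?_)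
    ⟨(|t₂ - t₁| / (2 * Real.pi) + 6 / Real.pi) * (|t₄ - t₃| / (2 * Real.pi) + 6 / Real.pi), ?_⟩ ?_
  · exact (((Complex.continuous_conj.comp (continuous_chiPoly t₁ t₂ p.1))).mul
      (continuous_chiPoly t₃ t₄ p.2)).aestronglyMeasurable
  · refine .of_forall fun p => .of_forall fun t => ?_
    rw [norm_mul, RCLike.norm_conj]
    exact mul_le_mul (norm_chiPoly_le _ _ _ _) (norm_chiPoly_le _ _ _ _) (norm_nonneg _)
      ((norm_nonneg _).trans (norm_chiPoly_le t₁ t₂ 0 t))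
  · filter_upwards [hν] with t ht
    rw [← prod_atTop_atTop_eq]
    exact ((Complex.continuous_conj.tendsto _).comp ((hG t ht).comp tendsto_fst)).mul
      ((hG' t ht).comp tendsto_snd)

/-- The values of the kernel at its jumps are left uncomputed: existence of the limit everywhere
suffices for the sequel. -/
theorem exists_chiLimit {t₁ t₂ : ℝ} (h₁ : t₁ ∈ Set.Icc (-Real.pi) Real.pi)
    (h₂ : t₂ ∈ Set.Icc (-Real.pi) Real.pi) :
    ∃ G : ℝ → ℂ, ∀ t ∈ Set.Ioc (-Real.pi) Real.pi,
      Tendsto (fun N => chiPoly t₁ t₂ N t) atTop (𝓝 (G t)) := by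
  have : ∀ t : ℝ, ∃ l : ℂ, t ∈ Set.Ioc (-Real.pi) Real.pi →
      Tendsto (fun N => chiPoly t₁ t₂ N t) atTop (𝓝 l) := by
    intro t
    by_cases ht : t ∈ Set.Ioc (-Real.pi) Real.pi
    · obtain ⟨l, hl⟩ := exists_tendsto_chiPoly h₁ h₂ (Set.Ioc_subset_Icc_self ht)
      exact ⟨l, fun _ => hl⟩
    · exact ⟨0, fun h => absurd h ht⟩
  choose G hG using this
  exact ⟨G, hG⟩

/-- In `‖a - b‖² = ⟨a,a⟩ - 2 Re⟨a,b⟩ + ⟨b,b⟩` all three inner products converge to the same number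
`L`. -/
theorem IsStationarySeq.cauchySeq_chiSum {w : ℤ → H} (hw : IsStationarySeq w) {t₁ t₂ : ℝ}
    (h₁ : t₁ ∈ Set.Icc (-Real.pi) Real.pi) (h₂ : t₂ ∈ Set.Icc (-Real.pi) Real.pi) :
    CauchySeq (chiSum w t₁ t₂) := by
  obtain ⟨ν, _, hν, hint⟩ := hw.exists_measure
  obtain ⟨G, hG⟩ := exists_chiLimit h₁ h₂
  have hlim := tendsto_inner_chiSum hν hint hG hG
  generalize (∫ t, starRingEnd ℂ (G t) * G t ∂ν) = L at hlim
  have hdiag : ∀ f : ℕ × ℕ → ℕ, Tendsto f atTop atTop →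
      Tendsto (fun p : ℕ × ℕ => inner ℂ (chiSum w t₁ t₂ (f p)) (chiSum w t₁ t₂ (f p))) atTop
        (𝓝 L) := fun f hf =>
    hlim.comp (f := fun p => (f p, f p)) ((hf.prodMk hf).mono_right prod_atTop_atTop_eq.le)
  have hf : Tendsto (Prod.fst : ℕ × ℕ → ℕ) atTop atTop := by
    rw [← prod_atTop_atTop_eq]; exact tendsto_fst
  have hs : Tendsto (Prod.snd : ℕ × ℕ → ℕ) atTop atTop := by
    rw [← prod_atTop_atTop_eq]; exact tendsto_snd
  have hre := fun {g : ℕ × ℕ → ℂ} (h : Tendsto g atTop (𝓝 L)) =>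
    (Complex.continuous_re.tendsto L).comp h
  rw [cauchySeq_iff_tendsto_dist_atTop_0]
  have hsq : Tendsto (fun p : ℕ × ℕ => dist (chiSum w t₁ t₂ p.1) (chiSum w t₁ t₂ p.2) ^ 2) atTop
      (𝓝 0) := by
    have h := ((hre (hdiag _ hf)).sub ((hre hlim).const_mul 2)).add (hre (hdiag _ hs))
    rw [show L.re - 2 * L.re + L.re = 0 by ring] at h
    refine h.congr fun p => ?_
    rw [dist_eq_norm, @norm_sub_sq ℂ, @norm_sq_eq_re_inner ℂ, @norm_sq_eq_re_inner ℂ]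
    rfl
  have := hsq.sqrt
  simpa [Real.sqrt_sq dist_nonneg] using this

/-- The exceptional set `s` is controlled through the Gram sequence, since the Herglotz measure is
only obtained inside the proof. Wiener's lemma makes `s` null, and off `s` the limiting integrand
vanishes. -/
theorem IsStationarySeq.tendsto_inner_chiSum_zero {w : ℤ → H} (hw : IsStationarySeq w) {s : Set ℝ}
    (hs : s.Countable) (hs' : s ⊆ Set.Ioc (-Real.pi) Real.pi)
    (hmass : ∀ τ ∈ s, Tendsto (cesaroMean (fun n => inner ℂ (w 0) (w n)) τ) atTop (𝓝 0))
    {t₁ t₂ t₃ t₄ : ℝ}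
    (h₁ : t₁ ∈ Set.Icc (-Real.pi) Real.pi) (h₂ : t₂ ∈ Set.Icc (-Real.pi) Real.pi)
    (h₃ : t₃ ∈ Set.Icc (-Real.pi) Real.pi) (h₄ : t₄ ∈ Set.Icc (-Real.pi) Real.pi)
    (h : ∀ t ∈ Set.Ioc (-Real.pi) Real.pi, t ∉ s →
      Tendsto (fun N => chiPoly t₁ t₂ N t) atTop (𝓝 0) ∨
        Tendsto (fun N => chiPoly t₃ t₄ N t) atTop (𝓝 0)) :
    Tendsto (fun N => inner ℂ (chiSum w t₁ t₂ N) (chiSum w t₃ t₄ N)) atTop (𝓝 0) := by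
  obtain ⟨ν, _, hν, hint⟩ := hw.exists_measure
  obtain ⟨G, hG⟩ := exists_chiLimit h₁ h₂
  obtain ⟨G', hG'⟩ := exists_chiLimit h₃ h₄
  have hlim := tendsto_inner_chiSum hν hint hG hG'
  have hnull : ν s = 0 := by
    rw [← Set.biUnion_of_singleton s, measure_biUnion_null_iff hs]
    intro τ hτ
    refine measure_singleton_eq_zero_of_cesaroMean hν (hs' hτ) ?_
    have := hmass τ hτ
    simpa only [hint, sub_zero] using this
  have hzero : ∫ t, starRingEnd ℂ (G t) * G' t ∂ν = 0 := by
    refine integral_eq_zero_of_ae ?_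
    filter_upwards [hν, measure_eq_zero_iff_ae_notMem.1 hnull] with t ht hts
    rcases h t ht hts with h0 | h0
    · simp [tendsto_nhds_unique (hG t ht) h0]
    · simp [tendsto_nhds_unique (hG' t ht) h0]
  rw [hzero] at hlim
  refine hlim.comp (f := fun N : ℕ => (N, N)) ?_
  rw [← prod_atTop_atTop_eq]
  exact tendsto_id.prodMk tendsto_id

variable {ι : Type*} {U : ι → ℤ → H} {c : ι → ι → ℤ → ℂ}

theorem isStationarySeq_add_smul (hU : ∀ i j k l, inner ℂ (U i k) (U j l) = c i j (l - k))
    (i j : ι) (α : ℂ) : IsStationarySeq (fun k => U i k + α • U j k) := by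
  intro k l n
  simp only [inner_add_left, inner_add_right, inner_smul_left, inner_smul_right, hU,
    add_sub_add_right_eq_sub]

theorem cesaroMean_add (c d : ℤ → ℂ) (τ : ℝ) (N : ℕ) :
    cesaroMean (fun n => c n + d n) τ N = cesaroMean c τ N + cesaroMean d τ N := by
  simp only [cesaroMean, mul_add, Finset.sum_add_distrib]

theorem cesaroMean_const_mul (a : ℂ) (c : ℤ → ℂ) (τ : ℝ) (N : ℕ) :
    cesaroMean (fun n => a * c n) τ N = a * cesaroMean c τ N := by
  simp only [cesaroMean, Finset.mul_sum]
  refine Finset.sum_congr rfl fun n _ => ?_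
  ring

theorem chiSum_add_smul (u v : ℤ → H) (α : ℂ) (t₁ t₂ : ℝ) (N : ℕ) :
    chiSum (fun k => u k + α • v k) t₁ t₂ N = chiSum u t₁ t₂ N + α • chiSum v t₁ t₂ N := by
  simp only [chiSum, smul_add, Finset.sum_add_distrib, Finset.smul_sum, smul_comm α]

/-- Spectral increments over arcs that are disjoint up to points without spectral mass are
asymptotically orthogonal. -/
theorem tendsto_inner_chiSum_zero
    (hU : ∀ i j k l, inner ℂ (U i k) (U j l) = c i j (l - k)) {s : Set ℝ}
    (hs : s.Countable) (hs' : s ⊆ Set.Ioc (-Real.pi) Real.pi)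
    (hmass : ∀ τ ∈ s, ∀ i j, Tendsto (cesaroMean (c i j) τ) atTop (𝓝 0))
    {t₁ t₂ t₃ t₄ : ℝ}
    (h₁ : t₁ ∈ Set.Icc (-Real.pi) Real.pi) (h₂ : t₂ ∈ Set.Icc (-Real.pi) Real.pi)
    (h₃ : t₃ ∈ Set.Icc (-Real.pi) Real.pi) (h₄ : t₄ ∈ Set.Icc (-Real.pi) Real.pi)
    (h : ∀ t ∈ Set.Ioc (-Real.pi) Real.pi, t ∉ s →
      Tendsto (fun N => chiPoly t₁ t₂ N t) atTop (𝓝 0) ∨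
        Tendsto (fun N => chiPoly t₃ t₄ N t) atTop (𝓝 0)) (i j : ι) :
    Tendsto (fun N => inner ℂ (chiSum (U i) t₁ t₂ N) (chiSum (U j) t₃ t₄ N)) atTop (𝓝 0) := by
  -- Each combination `U i + α U j` is a scalar stationary sequence, to which the scalar result
  -- applies.
  have hα : ∀ α : ℂ, Tendsto (fun N => inner ℂ
      (chiSum (U i) t₁ t₂ N + α • chiSum (U j) t₁ t₂ N)
      (chiSum (U i) t₃ t₄ N + α • chiSum (U j) t₃ t₄ N)) atTop (𝓝 0) := by
    intro α
    have := (isStationarySeq_add_smul hU i j α).tendsto_inner_chiSum_zero hs hs' ?_ h₁ h₂ h₃ h₄ h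
    · simpa only [chiSum_add_smul] using this
    intro τ hτ
    have he : (fun n => inner ℂ (U i 0 + α • U j 0) (U i n + α • U j n)) = fun n =>
        (c i i n + α * c i j n) + (starRingEnd ℂ α * c j i n +
          starRingEnd ℂ α * α * c j j n) := by
      funext n
      simp only [inner_add_left, inner_add_right, inner_smul_left, inner_smul_right, hU, sub_zero]
      ring
    rw [he]
    have hl := ((hmass τ hτ i i).add ((hmass τ hτ i j).const_mul α)).add
      (((hmass τ hτ j i).const_mul (starRingEnd ℂ α)).add
        ((hmass τ hτ j j).const_mul (starRingEnd ℂ α * α)))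
    simp only [mul_zero, add_zero] at hl
    refine hl.congr fun N => ?_
    simp only [cesaroMean_add, cesaroMean_const_mul]
  -- Polarization over `α = 1, -1, j, -j`. It holds for every sesquilinear form, so the two arcs may
  -- differ.
  have hsum := (((hα 1).sub (hα (-1))).add
    (((hα Complex.I).sub (hα (-Complex.I))).const_mul (-Complex.I))).const_mul (4⁻¹ : ℂ)
  simp only [sub_zero, mul_zero, add_zero] at hsum
  refine hsum.congr fun N => ?_
  simp only [inner_add_left, inner_add_right, inner_smul_left, inner_smul_right, map_neg, map_one,
    Complex.conj_I]
  linear_combination (-(1 / 2 : ℂ) * inner ℂ (chiSum (U i) t₁ t₂ N) (chiSum (U j) t₃ t₄ N) +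
    (1 / 2 : ℂ) * inner ℂ (chiSum (U j) t₁ t₂ N) (chiSum (U i) t₃ t₄ N)) * Complex.I_sq

end Hilbert

/-! ### Atoms of the matrix-valued spectral measure -/

section ComplexMeasure

variable {X : Type*} [MeasurableSpace X] (F : ComplexMeasure X)

theorem vectorIntegral_const_mul (a : ℂ) (f : X → ℂ) :
    ∫ᵛ t, a * f t ∂[ContinuousLinearMap.mul ℝ ℂ; F] =
      a * ∫ᵛ t, f t ∂[ContinuousLinearMap.mul ℝ ℂ; F] := by
  rw [VectorMeasure.integral_eq_setToFun, VectorMeasure.integral_eq_setToFun]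
  refine setToFun_smul (𝕜 := ℂ) _ (fun c s x => ?_) a f
  exact mul_assoc c x (F s)

theorem vectorIntegral_indicator_one [IsFiniteMeasure F.variation] {s : Set X}
    (hs : MeasurableSet s) :
    ∫ᵛ t, s.indicator (fun _ => (1 : ℂ)) t ∂[ContinuousLinearMap.mul ℝ ℂ; F] = F s := by
  rw [VectorMeasure.integral_eq_setToFun]
  refine (setToFun_indicator_const _ hs (measure_ne_top _ _) (1 : ℂ)).trans ?_
  exact one_mul (F s)

end ComplexMeasure

section SpectralMass

variable {Ω : Type*} [MeasurableSpace Ω] {m : ℕ} {μ : Measure Ω}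
  {y : ℤ → Ω → EuclideanSpace ℝ (Fin m)}

theorem cesaroMean_vectorIntegral (F : ComplexMeasure ℝ) [IsFiniteMeasure F.variation] (τ : ℝ)
    (N : ℕ) :
    cesaroMean (fun n => ∫ᵛ t, Complex.exp (Complex.I * n * (t : ℂ))
      ∂[ContinuousLinearMap.mul ℝ ℂ; F]) τ N =
      ∫ᵛ t, meanKernel N (t - τ) ∂[ContinuousLinearMap.mul ℝ ℂ; F] := by
  simp only [cesaroMean, meanKernel]
  rw [vectorIntegral_const_mul, VectorMeasure.integral_finsetSum]
  · congr 1
    refine Finset.sum_congr rfl fun n _ => ?_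
    rw [← vectorIntegral_const_mul]
    congr 1
    funext t
    rw [← Complex.exp_add]
    congr 1
    push_cast
    ring
  · intro n _
    refine Integrable.of_bound (C := 1) (by fun_prop) (.of_forall fun t => ?_)
    exact (norm_exp_I_mul_nat_mul n (t - τ)).le

/-- If the spectral measure has no atom at `τ`, then the Cesàro means of the covariance lags vanish
at the frequency `τ`. -/
theorem NoSpectralMassAt.tendsto_cesaroMean {τ : ℝ} (h : NoSpectralMassAt μ y τ)
    (hτ : τ ∈ Set.Ioc (-Real.pi) Real.pi) (i j : Fin m) :
    Tendsto (cesaroMean (fun n => ((covLag μ y n i j : ℝ) : ℂ)) τ) atTop (𝓝 0) := by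
  obtain ⟨F, hF, hmass⟩ := h
  simp_rw [hF.covLag_eq]
  by_cases hfin : IsFiniteMeasure (F i j).variation
  · have hsupp : ∀ᵐ t ∂(F i j).variation, t ∈ Set.Ioc (-Real.pi) Real.pi := by
      refine (VectorMeasure.variation_apply_eq_zero measurableSet_Ioc.compl).2 fun A hA hAm => ?_
      exact hF.supported i j A hAm (Set.disjoint_left.2 fun x hx => hA hx)
    have h1 : Tendsto (fun N => ∫ᵛ t, meanKernel N (t - τ) ∂[ContinuousLinearMap.mul ℝ ℂ; F i j])
        atTop (𝓝 (∫ᵛ t, ({τ} : Set ℝ).indicator (fun _ => (1 : ℂ)) t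
          ∂[ContinuousLinearMap.mul ℝ ℂ; F i j])) := by
      refine VectorMeasure.tendsto_integral_of_dominated_convergence (fun _ => 1) (fun N => ?_)
        (integrable_const _) (fun N => .of_forall fun t => norm_meanKernel_le _ _) ?_
      · exact ((continuous_meanKernel N).comp (by fun_prop)).aestronglyMeasurable
      · filter_upwards [hsupp] with t ht using tendsto_meanKernel ht hτ
    rw [vectorIntegral_indicator_one _ (measurableSet_singleton τ), hmass i j] at h1
    have h2 := h1.const_mul ((2 * (Real.pi : ℂ))⁻¹)
    rw [mul_zero] at h2
    refine h2.congr fun N => ?_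
    rw [cesaroMean_const_mul, cesaroMean_vectorIntegral]
  -- If the variation were infinite, the exponentials, having modulus one, would not be integrable;
  -- their integrals would take the default value `0` and all lags would vanish.
  · have h0 : ∀ n : ℤ, ∫ᵛ t, Complex.exp (Complex.I * n * (t : ℂ))
        ∂[ContinuousLinearMap.mul ℝ ℂ; F i j] = 0 := by
      intro n
      refine VectorMeasure.integral_undef fun hint => hfin ?_
      have h1 : Integrable (fun _ : ℝ => (1 : ℝ)) (F i j).variation :=
        hint.norm.congr (.of_forall fun t => norm_exp_I_mul_int_mul n t)
      simpa [integrable_const_iff] using h1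
    simp only [h0, mul_zero]
    refine tendsto_const_nhds.congr fun N => ?_
    simp [cesaroMean]

end SpectralMass

/-! ### Mean-square limits of Gaussian vectors -/

section MeanSquare

variable {Ω : Type*} [MeasurableSpace Ω] {μ : Measure Ω}

/-- Second moments are continuous under mean-square convergence. -/
theorem tendsto_integral_inner_of_L2 {𝕜 E : Type*} [RCLike 𝕜] [NormedAddCommGroup E]
    [InnerProductSpace 𝕜 E] {f g : ℕ → Ω → E} {f' g' : Ω → E}
    (hf : ∀ n, MemLp (f n) 2 μ) (hg : ∀ n, MemLp (g n) 2 μ) (hf' : MemLp f' 2 μ)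
    (hg' : MemLp g' 2 μ) (hff' : Tendsto (fun n => eLpNorm (f n - f') 2 μ) atTop (𝓝 0))
    (hgg' : Tendsto (fun n => eLpNorm (g n - g') 2 μ) atTop (𝓝 0)) :
    Tendsto (fun n => ∫ ω, inner 𝕜 (f n ω) (g n ω) ∂μ) atTop
      (𝓝 (∫ ω, inner 𝕜 (f' ω) (g' ω) ∂μ)) := by
  have h1 := (Lp.tendsto_Lp_iff_tendsto_eLpNorm'' f hf f' hf').2 hff'
  have h2 := (Lp.tendsto_Lp_iff_tendsto_eLpNorm'' g hg g' hg').2 hgg'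
  have h3 := h1.inner (𝕜 := 𝕜) h2
  have key : ∀ {a b : Ω → E} (ha : MemLp a 2 μ) (hb : MemLp b 2 μ),
      inner 𝕜 (ha.toLp a) (hb.toLp b) = ∫ ω, inner 𝕜 (a ω) (b ω) ∂μ := by
    intro a b ha hb
    rw [L2.inner_def]
    refine integral_congr_ae ?_
    filter_upwards [ha.coeFn_toLp, hb.coeFn_toLp] with ω h h'
    rw [h, h']
  simpa only [key] using h3

theorem tendsto_integral_of_L2 [IsProbabilityMeasure μ] {E : Type*} [NormedAddCommGroup E]
    [NormedSpace ℝ E] {f : ℕ → Ω → E} {f' : Ω → E} (hf : ∀ n, MemLp (f n) 2 μ)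
    (hf' : MemLp f' 2 μ) (hff' : Tendsto (fun n => eLpNorm (f n - f') 2 μ) atTop (𝓝 0)) :
    Tendsto (fun n => ∫ ω, f n ω ∂μ) atTop (𝓝 (∫ ω, f' ω ∂μ)) := by
  refine tendsto_integral_of_L1' f' hf'.1 (.of_forall fun n => (hf n).integrable one_le_two) ?_
  exact tendsto_of_tendsto_of_tendsto_of_le_of_le tendsto_const_nhds hff' (fun _ => zero_le)
    fun n => eLpNorm_le_eLpNorm_of_exponent_le one_le_two ((hf n).sub hf').1

theorem tendsto_eLpNorm_clm_comp {E F : Type*} [NormedAddCommGroup E] [NormedSpace ℝ E]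
    [NormedAddCommGroup F] [NormedSpace ℝ F] (L : E →L[ℝ] F) {f : ℕ → Ω → E} {f' : Ω → E}
    (h : Tendsto (fun n => eLpNorm (f n - f') 2 μ) atTop (𝓝 0)) :
    Tendsto (fun n => eLpNorm (L ∘ f n - L ∘ f') 2 μ) atTop (𝓝 0) := by
  have hb : ∀ n, eLpNorm (L ∘ f n - L ∘ f') 2 μ ≤
      ENNReal.ofReal ‖L‖ * eLpNorm (f n - f') 2 μ := fun n => by
    refine eLpNorm_le_mul_eLpNorm_of_ae_le_mul (.of_forall fun ω => ?_) 2
    simp only [Pi.sub_apply, Function.comp_apply, ← map_sub]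
    exact L.le_opNorm _
  refine tendsto_of_tendsto_of_tendsto_of_le_of_le tendsto_const_nhds ?_ (fun _ => zero_le) hb
  have := ENNReal.Tendsto.const_mul (a := ENNReal.ofReal ‖L‖) h (Or.inr ENNReal.ofReal_ne_top)
  rwa [mul_zero] at this

theorem norm_exp_mul_I_sub_le (a b : ℝ) :
    ‖Complex.exp (a * Complex.I) - Complex.exp (b * Complex.I)‖ ≤ ‖a - b‖ := by
  have : Complex.exp (a * Complex.I) - Complex.exp (b * Complex.I) =
      Complex.exp (b * Complex.I) * (Complex.exp (Complex.I * (a - b : ℝ)) - 1) := by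
    rw [mul_sub, ← Complex.exp_add, mul_one]
    congr 2
    push_cast; ring
  rw [this, norm_mul, Complex.norm_exp_ofReal_mul_I, one_mul]
  exact Real.norm_exp_I_mul_ofReal_sub_one_le

/-- A mean-square limit of Gaussian random vectors is Gaussian. -/
theorem hasGaussianLaw_of_tendsto_L2 [IsProbabilityMeasure μ] {E : Type*} [NormedAddCommGroup E]
    [NormedSpace ℝ E] [CompleteSpace E] [SecondCountableTopology E] [MeasurableSpace E]
    [BorelSpace E] {X : ℕ → Ω → E} {X' : Ω → E} (hX : ∀ n, HasGaussianLaw (X n) μ)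
    (hX' : MemLp X' 2 μ) (h : Tendsto (fun n => eLpNorm (X n - X') 2 μ) atTop (𝓝 0)) :
    HasGaussianLaw X' μ := by
  have hmeas : AEMeasurable X' μ := hX'.1.aemeasurable
  -- A Gaussian characteristic functional at `L` depends only on the mean and variance of `L ∘ X`.
  -- Both pass to the limit, as does the functional itself, because `a ↦ e^{ja}` is 1-Lipschitz.
  refine (hasGaussianLaw_iff_charFunDual_map_eq hmeas).2 fun L => ?_
  have hL := tendsto_eLpNorm_clm_comp L h
  have hLX : ∀ n, MemLp (L ∘ X n) 2 μ := fun n => L.comp_memLp' (hX n).memLp_two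
  have hLX' : MemLp (L ∘ X') 2 μ := L.comp_memLp' hX'
  have hmean := tendsto_integral_of_L2 hLX hLX' hL
  have hsq := tendsto_integral_inner_of_L2 (𝕜 := ℝ) hLX hLX hLX' hLX' hL hL
  have hvar : Tendsto (fun n => Var[L ∘ X n; μ]) atTop (𝓝 Var[L ∘ X'; μ]) := by
    have e : ∀ {Y : Ω → ℝ}, MemLp Y 2 μ →
        Var[Y; μ] = ∫ ω, inner ℝ (Y ω) (Y ω) ∂μ - (∫ ω, Y ω ∂μ) ^ 2 := by
      intro Y hY
      rw [variance_eq_sub hY]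
      congr 1
      refine integral_congr_ae (.of_forall fun ω => ?_)
      simp [pow_two]
    rw [e hLX']
    simp_rw [fun n => e (hLX n)]
    exact hsq.sub (hmean.pow 2)
  have hchar : Tendsto (fun n => charFunDual (μ.map (X n)) L) atTop
      (𝓝 (charFunDual (μ.map X') L)) := by
    have e : ∀ {Y : Ω → E}, AEMeasurable Y μ →
        charFunDual (μ.map Y) L = ∫ ω, Complex.exp ((L ∘ Y) ω * Complex.I) ∂μ := by
      intro Y hY
      rw [charFunDual_apply, integral_map hY (by fun_prop)]
      rfl
    rw [e hmeas]
    simp_rw [fun n => e (hX n).aemeasurable]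
    have hm : ∀ {Y : Ω → ℝ}, AEStronglyMeasurable Y μ →
        AEStronglyMeasurable (fun ω => Complex.exp (Y ω * Complex.I)) μ := fun hY =>
      (by fun_prop : Continuous fun x : ℝ => Complex.exp (x * Complex.I)).comp_aestronglyMeasurable
        hY
    refine tendsto_integral_of_L1' _ (hm hLX'.1) (.of_forall fun n => ?_) ?_
    · exact Integrable.of_bound (C := 1) (hm (hLX n).1)
        (.of_forall fun ω => (Complex.norm_exp_ofReal_mul_I _).le)
    · refine tendsto_of_tendsto_of_tendsto_of_le_of_le tendsto_const_nhds hL (fun _ => zero_le)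
        fun n => ?_
      refine le_trans ?_ (eLpNorm_le_eLpNorm_of_exponent_le one_le_two ((hLX n).sub hLX').1)
      exact eLpNorm_mono fun ω => norm_exp_mul_I_sub_le _ _
  refine tendsto_nhds_unique hchar ?_
  simp_rw [fun n => (hX n).charFunDual_map_eq L]
  refine (Complex.continuous_exp.tendsto _).comp (Tendsto.sub ?_ ?_)
  · exact ((Complex.continuous_ofReal.tendsto _).comp hmean).mul_const _
  · exact ((Complex.continuous_ofReal.tendsto _).comp hvar).div_const _

end MeanSquare

/-! ### Spectral increments as mean-square limits -/

section Increments

variable {Ω : Type*} [MeasurableSpace Ω] {m : ℕ} {μ : Measure Ω}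
  {y : ℤ → Ω → EuclideanSpace ℝ (Fin m)}

theorem memLp_ofReal_coord (hy : IsStationaryGaussian μ y) (i : Fin m) (k : ℤ) :
    MemLp (fun ω => ((y k ω i : ℝ) : ℂ)) 2 μ :=
  (Complex.ofRealCLM.comp (EuclideanSpace.proj i : EuclideanSpace ℝ (Fin m) →L[ℝ] ℝ)).comp_memLp'
    (hy.gaussian.hasGaussianLaw_eval k).memLp_two

theorem memLp_two_coord {Z : Ω → EuclideanSpace ℂ (Fin m)} (hZ : MemLp Z 2 μ) (i : Fin m) :
    MemLp (fun ω => Z ω i) 2 μ :=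
  (EuclideanSpace.proj i : EuclideanSpace ℂ (Fin m) →L[ℂ] ℂ).comp_memLp' hZ

/-- The component sequences of the process as elements of `L²`. -/
def coordLp (hy : IsStationaryGaussian μ y) (i : Fin m) (k : ℤ) : Lp ℂ 2 μ :=
  (memLp_ofReal_coord hy i k).toLp _

theorem inner_toLp {f g : Ω → ℂ} (hf : MemLp f 2 μ) (hg : MemLp g 2 μ) :
    inner ℂ (hf.toLp f) (hg.toLp g) = ∫ ω, starRingEnd ℂ (f ω) * g ω ∂μ := by
  rw [L2.inner_def]
  refine integral_congr_ae ?_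
  filter_upwards [hf.coeFn_toLp, hg.coeFn_toLp] with ω h h'
  rw [h, h', RCLike.inner_apply, mul_comm]

/-- The lag sits on the second argument, hence the transposed indices `j i`. -/
theorem inner_coordLp (hy : IsStationaryGaussian μ y) (i j : Fin m) (k l : ℤ) :
    inner ℂ (coordLp hy i k) (coordLp hy j l) = ((covLag μ y (l - k) j i : ℝ) : ℂ) := by
  rw [coordLp, coordLp, inner_toLp]
  have h := hy.stationary k (l - k) j i
  rw [add_sub_cancel] at h
  rw [covLag, Matrix.of_apply, ← h, ← integral_complex_ofReal]
  refine integral_congr_ae (.of_forall fun ω => ?_)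
  simp [mul_comm]

omit [MeasurableSpace Ω] in
theorem partialSum_apply (t₁ t₂ : ℝ) (N : ℕ) (ω : Ω) (i : Fin m) :
    partialSum y t₁ t₂ N ω i =
      ∑ k ∈ Finset.Icc (-(N : ℤ)) (N : ℤ), chi k t₁ t₂ * ((y k ω i : ℝ) : ℂ) := by
  simp [partialSum]

/-- The linear map sending finitely many values of the process to a partial sum. -/
def partialSumCLM (m : ℕ) (t₁ t₂ : ℝ) (N : ℕ) :
    ((Finset.Icc (-(N : ℤ)) (N : ℤ)) → EuclideanSpace ℝ (Fin m)) →L[ℝ]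
      EuclideanSpace ℂ (Fin m) :=
  LinearMap.toContinuousLinearMap
    { toFun := fun x => WithLp.toLp 2 fun i =>
        ∑ k : Finset.Icc (-(N : ℤ)) (N : ℤ), chi (k : ℤ) t₁ t₂ * ((x k i : ℝ) : ℂ)
      map_add' := fun a b => by
        ext i
        simp [mul_add, Finset.sum_add_distrib]
      map_smul' := fun r a => by
        ext i
        simp [Finset.mul_sum, mul_left_comm] }

omit [MeasurableSpace Ω] in
theorem partialSum_eq_clm (t₁ t₂ : ℝ) (N : ℕ) (ω : Ω) :
    partialSum y t₁ t₂ N ω =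
      partialSumCLM m t₁ t₂ N ((Finset.Icc (-(N : ℤ)) (N : ℤ)).restrict fun k => y k ω) := by
  ext i
  rw [partialSum_apply, ← Finset.sum_coe_sort]
  rfl

/-- Both sums involve the same finitely many `y_k`, so the pair is one linear image of a Gaussian
vector. Joint normality is what independence requires. -/
theorem hasGaussianLaw_partialSum_prod (hy : IsStationaryGaussian μ y) (t₁ t₂ t₃ t₄ : ℝ) (N : ℕ) :
    HasGaussianLaw (fun ω => (partialSum y t₁ t₂ N ω, partialSum y t₃ t₄ N ω)) μ := by
  have := (hy.gaussian.hasGaussianLaw (Finset.Icc (-(N : ℤ)) (N : ℤ))).map_fun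
    ((partialSumCLM m t₁ t₂ N).prod (partialSumCLM m t₃ t₄ N))
  refine this.congr (.of_forall fun ω => ?_)
  simp only [partialSum_eq_clm]
  rfl

theorem memLp_partialSum (hy : IsStationaryGaussian μ y) (t₁ t₂ : ℝ) (N : ℕ) :
    MemLp (partialSum y t₁ t₂ N) 2 μ :=
  (hasGaussianLaw_partialSum_prod hy t₁ t₂ t₁ t₂ N).fst.memLp_two

theorem chiSum_coordLp (hy : IsStationaryGaussian μ y) (i : Fin m) (t₁ t₂ : ℝ) (N : ℕ) :
    chiSum (coordLp hy i) t₁ t₂ N =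
      (memLp_two_coord (memLp_partialSum hy t₁ t₂ N) i).toLp _ := by
  refine Lp.ext ?_
  have h : ∀ᵐ ω ∂μ, ∀ k : ℤ, (chi k t₁ t₂ • coordLp hy i k : Lp ℂ 2 μ) ω =
      chi k t₁ t₂ * ((y k ω i : ℝ) : ℂ) := by
    rw [ae_all_iff]
    intro k
    filter_upwards [Lp.coeFn_smul (chi k t₁ t₂) (coordLp hy i k),
      (memLp_ofReal_coord hy i k).coeFn_toLp] with ω h1 h2
    rw [h1, Pi.smul_apply, smul_eq_mul, coordLp, h2]
  filter_upwards [h, Lp.coeFn_finsetSum (Finset.Icc (-(N : ℤ)) (N : ℤ))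
    (fun k => chi k t₁ t₂ • coordLp hy i k),
    (memLp_two_coord (memLp_partialSum hy t₁ t₂ N) i).coeFn_toLp] with ω h1 h2 h3
  rw [h3, partialSum_apply, chiSum, h2, Finset.sum_apply]
  exact Finset.sum_congr rfl fun k _ => h1 k

theorem IsSpectralIncrement.tendsto_chiSum (hy : IsStationaryGaussian μ y) {t₁ t₂ : ℝ}
    {Z : Ω → EuclideanSpace ℂ (Fin m)} (hZ : IsSpectralIncrement μ y t₁ t₂ Z) (i : Fin m) :
    Tendsto (chiSum (coordLp hy i) t₁ t₂) atTop (𝓝 ((memLp_two_coord hZ.memLp i).toLp _)) := by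
  have h : chiSum (coordLp hy i) t₁ t₂ = fun N =>
      (memLp_two_coord (memLp_partialSum hy t₁ t₂ N) i).toLp _ :=
    funext fun N => chiSum_coordLp hy i t₁ t₂ N
  rw [h]
  refine (Lp.tendsto_Lp_iff_tendsto_eLpNorm'' (fun N ω => partialSum y t₁ t₂ N ω i)
    (fun N => memLp_two_coord (memLp_partialSum hy t₁ t₂ N) i) _ (memLp_two_coord hZ.memLp i)).2 ?_
  refine tendsto_of_tendsto_of_tendsto_of_le_of_le tendsto_const_nhds hZ.tendsto
    (fun _ => zero_le) fun N => ?_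
  exact eLpNorm_mono fun ω => PiLp.norm_apply_le (partialSum y t₁ t₂ N ω - Z ω) i

theorem exists_isSpectralIncrement (hy : IsStationaryGaussian μ y) {t₁ t₂ : ℝ}
    (h₁ : t₁ ∈ Set.Icc (-Real.pi) Real.pi) (h₂ : t₂ ∈ Set.Icc (-Real.pi) Real.pi) :
    ∃ Z, IsSpectralIncrement μ y t₁ t₂ Z := by
  have hlim : ∀ i, ∃ W, Tendsto (chiSum (coordLp hy i) t₁ t₂) atTop (𝓝 W) := fun i => by
    -- The choice `α = 0` yields stationarity of a single component.
    have hst := isStationarySeq_add_smul (U := coordLp hy)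
      (c := fun i j n => ((covLag μ y n j i : ℝ) : ℂ)) (inner_coordLp hy) i i 0
    simp only [zero_smul, add_zero] at hst
    exact cauchySeq_tendsto_of_complete (hst.cauchySeq_chiSum h₁ h₂)
  choose W hW using hlim
  have hmem : ∀ i, MemLp (fun ω => W i ω) 2 μ := fun i => Lp.memLp (W i)
  have hnorm : ∀ x : EuclideanSpace ℂ (Fin m), ‖x‖ ≤ ∑ i, ‖x i‖ := fun x => by
    calc ‖x‖ = ‖∑ i, EuclideanSpace.single i (x i)‖ := by
          congr 1
          ext j
          simp [Finset.sum_apply, Pi.single_apply]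
      _ ≤ ∑ i, ‖EuclideanSpace.single i (x i)‖ := norm_sum_le _ _
      _ = _ := by simp
  refine ⟨fun ω => WithLp.toLp 2 fun i => W i ω, ⟨?_, ?_⟩⟩
  · exact MemLp.of_eval_piLp hmem
  · have hi : ∀ i, Tendsto (fun N => eLpNorm (fun ω => partialSum y t₁ t₂ N ω i - W i ω) 2 μ)
        atTop (𝓝 0) := by
      intro i
      have h := hW i
      rw [show chiSum (coordLp hy i) t₁ t₂ = fun N =>
        (memLp_two_coord (memLp_partialSum hy t₁ t₂ N) i).toLp _ from
        funext fun N => chiSum_coordLp hy i t₁ t₂ N, ← Lp.toLp_coeFn (W i) (hmem i)] at h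
      exact (Lp.tendsto_Lp_iff_tendsto_eLpNorm'' (fun N ω => partialSum y t₁ t₂ N ω i)
        (fun N => memLp_two_coord (memLp_partialSum hy t₁ t₂ N) i) _ (hmem i)).1 h
    have hsum := tendsto_finsetSum Finset.univ fun i _ => hi i
    simp only [Finset.sum_const_zero] at hsum
    refine tendsto_of_tendsto_of_tendsto_of_le_of_le tendsto_const_nhds hsum
      (fun _ => zero_le) fun N => ?_
    have hm : ∀ i, AEStronglyMeasurable (fun ω => ‖partialSum y t₁ t₂ N ω i - W i ω‖) μ := fun i =>
      ((memLp_two_coord (memLp_partialSum hy t₁ t₂ N) i).sub (hmem i)).1.norm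
    calc _ ≤ eLpNorm (∑ i, fun ω => ‖partialSum y t₁ t₂ N ω i - W i ω‖) 2 μ := by
          refine eLpNorm_mono_real fun ω => (hnorm _).trans_eq ?_
          simp [Finset.sum_apply]
      _ ≤ ∑ i, eLpNorm (fun ω => ‖partialSum y t₁ t₂ N ω i - W i ω‖) 2 μ :=
          eLpNorm_sum_le (fun i _ => hm i) one_le_two
      _ = _ := by simp only [eLpNorm_norm]

theorem isSpectralIncrement_yhat (hy : IsStationaryGaussian μ y) {t₁ t₂ : ℝ}
    (h₁ : t₁ ∈ Set.Icc (-Real.pi) Real.pi) (h₂ : t₂ ∈ Set.Icc (-Real.pi) Real.pi) :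
    IsSpectralIncrement μ y t₁ t₂ (yhat μ y t₁ t₂) := by
  have h := exists_isSpectralIncrement hy h₁ h₂
  rw [yhat, dif_pos h]
  exact h.choose_spec

theorem IsSpectralIncrement.ae_eq (hy : IsStationaryGaussian μ y) {t₁ t₂ : ℝ}
    {Z Z' : Ω → EuclideanSpace ℂ (Fin m)} (hZ : IsSpectralIncrement μ y t₁ t₂ Z)
    (hZ' : IsSpectralIncrement μ y t₁ t₂ Z') : Z =ᵐ[μ] Z' := by
  have h := (Lp.tendsto_Lp_iff_tendsto_eLpNorm'' _ (memLp_partialSum hy t₁ t₂) Z hZ.memLp).2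
    hZ.tendsto
  have h' := (Lp.tendsto_Lp_iff_tendsto_eLpNorm'' _ (memLp_partialSum hy t₁ t₂) Z' hZ'.memLp).2
    hZ'.tendsto
  exact (MemLp.toLp_eq_toLp_iff _ _).1 (tendsto_nhds_unique h h')

/-- This is the source of the Hermitian symmetry: the `y_k` are real, so conjugation acts on the
coefficients alone. -/
theorem conj_chi (k : ℤ) (t₁ t₂ : ℝ) : starRingEnd ℂ (chi k t₁ t₂) = chi k (-t₂) (-t₁) := by
  simp only [chi]
  split_ifs
  · simp only [map_div₀, map_sub, map_mul, Complex.conj_ofReal, map_ofNat]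
    push_cast
    ring
  · simp only [map_div₀, map_sub, map_mul, map_neg, ← Complex.exp_conj, Complex.conj_ofReal,
      map_ofNat, map_intCast, Complex.conj_I]
    rw [← neg_div_neg_eq, neg_sub]
    push_cast
    ring_nf

/-- The componentwise complex conjugate of a vector. -/
def conjVec (z : EuclideanSpace ℂ (Fin m)) : EuclideanSpace ℂ (Fin m) :=
  WithLp.toLp 2 fun i => starRingEnd ℂ (z i)

theorem norm_conjVec (z : EuclideanSpace ℂ (Fin m)) : ‖conjVec z‖ = ‖z‖ := by
  simp [EuclideanSpace.norm_eq, conjVec]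

theorem conjVec_sub (z w : EuclideanSpace ℂ (Fin m)) :
    conjVec (z - w) = conjVec z - conjVec w := by
  ext i
  simp [conjVec]

theorem continuous_conjVec : Continuous (conjVec (m := m)) := by
  refine (PiLp.continuous_toLp 2 _).comp (continuous_pi fun i => ?_)
  exact Complex.continuous_conj.comp (EuclideanSpace.proj i).continuous

omit [MeasurableSpace Ω] in
theorem conjVec_partialSum (t₁ t₂ : ℝ) (N : ℕ) (ω : Ω) :
    conjVec (partialSum y t₁ t₂ N ω) = partialSum y (-t₂) (-t₁) N ω := by
  ext i
  rw [partialSum_apply, conjVec]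
  simp only [partialSum_apply, map_sum, map_mul, conj_chi, Complex.conj_ofReal]

theorem IsSpectralIncrement.conj {t₁ t₂ : ℝ} {Z : Ω → EuclideanSpace ℂ (Fin m)}
    (hZ : IsSpectralIncrement μ y t₁ t₂ Z) :
    IsSpectralIncrement μ y (-t₂) (-t₁) fun ω => conjVec (Z ω) where
  memLp := hZ.memLp.of_le (continuous_conjVec.comp_aestronglyMeasurable hZ.memLp.1)
    (.of_forall fun ω => (norm_conjVec _).le)
  tendsto := by
    refine hZ.tendsto.congr fun N => eLpNorm_congr_norm_ae (.of_forall fun ω => ?_)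
    rw [← conjVec_partialSum, ← conjVec_sub, norm_conjVec]

theorem IsSpectralIncrement.hasGaussianLaw_prod [IsProbabilityMeasure μ]
    (hy : IsStationaryGaussian μ y) {t₁ t₂ t₃ t₄ : ℝ}
    {Z Z' : Ω → EuclideanSpace ℂ (Fin m)} (hZ : IsSpectralIncrement μ y t₁ t₂ Z)
    (hZ' : IsSpectralIncrement μ y t₃ t₄ Z') : HasGaussianLaw (fun ω => (Z ω, Z' ω)) μ := by
  refine hasGaussianLaw_of_tendsto_L2 (fun N => hasGaussianLaw_partialSum_prod hy t₁ t₂ t₃ t₄ N)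
    (memLp_prod_iff.2 ⟨hZ.memLp, hZ'.memLp⟩) ?_
  have hsum := hZ.tendsto.add hZ'.tendsto
  rw [add_zero] at hsum
  refine tendsto_of_tendsto_of_tendsto_of_le_of_le tendsto_const_nhds hsum
    (fun _ => zero_le) fun N => ?_
  have hm := ((memLp_partialSum hy t₁ t₂ N).sub hZ.memLp).1.norm
  have hm' := ((memLp_partialSum hy t₃ t₄ N).sub hZ'.memLp).1.norm
  refine le_trans ?_ ((eLpNorm_add_le hm hm' one_le_two).trans_eq ?_)
  · refine eLpNorm_mono_real fun ω => ?_
    exact max_le_add_of_nonneg (norm_nonneg _) (norm_nonneg _)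
  · rw [eLpNorm_norm, eLpNorm_norm]
    rfl

theorem IsSpectralIncrement.integral_eq_zero [IsProbabilityMeasure μ]
    (hy : IsStationaryGaussian μ y) {t₁ t₂ : ℝ} {Z : Ω → EuclideanSpace ℂ (Fin m)}
    (hZ : IsSpectralIncrement μ y t₁ t₂ Z) (i : Fin m) : ∫ ω, Z ω i ∂μ = 0 := by
  have hN : ∀ N, ∫ ω, partialSum y t₁ t₂ N ω i ∂μ = 0 := by
    intro N
    simp_rw [partialSum_apply]
    rw [integral_finsetSum _ fun k _ =>
      ((memLp_ofReal_coord hy i k).integrable one_le_two).const_mul _]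
    refine Finset.sum_eq_zero fun k _ => ?_
    rw [integral_const_mul, integral_complex_ofReal, hy.mean_zero, Complex.ofReal_zero, mul_zero]
  have h := tendsto_integral_of_L2 (fun N => memLp_two_coord (memLp_partialSum hy t₁ t₂ N) i)
    (memLp_two_coord hZ.memLp i) ?_
  · simp only [hN] at h
    exact tendsto_nhds_unique h tendsto_const_nhds
  · refine tendsto_of_tendsto_of_tendsto_of_le_of_le tendsto_const_nhds hZ.tendsto
      (fun _ => zero_le) fun N => ?_
    exact eLpNorm_mono fun ω => PiLp.norm_apply_le (partialSum y t₁ t₂ N ω - Z ω) i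

/-- Spectral increments over arcs that are disjoint up to points without spectral mass are
uncorrelated. -/
theorem IsSpectralIncrement.integral_conj_mul_eq_zero (hy : IsStationaryGaussian μ y) {s : Set ℝ}
    (hs : s.Countable) (hs' : s ⊆ Set.Ioc (-Real.pi) Real.pi)
    (hmass : ∀ τ ∈ s, NoSpectralMassAt μ y τ) {t₁ t₂ t₃ t₄ : ℝ}
    (h₁ : t₁ ∈ Set.Icc (-Real.pi) Real.pi) (h₂ : t₂ ∈ Set.Icc (-Real.pi) Real.pi)
    (h₃ : t₃ ∈ Set.Icc (-Real.pi) Real.pi) (h₄ : t₄ ∈ Set.Icc (-Real.pi) Real.pi)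
    (h : ∀ t ∈ Set.Ioc (-Real.pi) Real.pi, t ∉ s →
      Tendsto (fun N => chiPoly t₁ t₂ N t) atTop (𝓝 0) ∨
        Tendsto (fun N => chiPoly t₃ t₄ N t) atTop (𝓝 0))
    {Z Z' : Ω → EuclideanSpace ℂ (Fin m)} (hZ : IsSpectralIncrement μ y t₁ t₂ Z)
    (hZ' : IsSpectralIncrement μ y t₃ t₄ Z') (i j : Fin m) :
    ∫ ω, starRingEnd ℂ (Z ω i) * Z' ω j ∂μ = 0 := by
  rw [← inner_toLp (memLp_two_coord hZ.memLp i) (memLp_two_coord hZ'.memLp j)]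
  refine tendsto_nhds_unique ((hZ.tendsto_chiSum hy i).inner (hZ'.tendsto_chiSum hy j)) ?_
  exact tendsto_inner_chiSum_zero (U := coordLp hy)
    (c := fun i j n => ((covLag μ y n j i : ℝ) : ℂ)) (inner_coordLp hy) hs hs'
    (fun τ hτ i j => (hmass τ hτ).tendsto_cesaroMean (hs' hτ) j i) h₁ h₂ h₃ h₄ h i j

end Increments

/-! ### Circular symmetry and independence -/

section Properties

/-- The hypothesis `hend` excludes `t = π` with an endpoint `-π`: these are the same point of the
circle, so `t` would be a jump of the kernel. -/
theorem tendsto_chiPoly_zero_of_notMem_Icc {t₁ t₂ t : ℝ} (h₁ : t₁ ∈ Set.Icc (-Real.pi) Real.pi)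
    (h₂ : t₂ ∈ Set.Icc (-Real.pi) Real.pi) (ht : t ∈ Set.Ioc (-Real.pi) Real.pi) (h : t₁ ≤ t₂)
    (hend : t = Real.pi → t₁ ≠ -Real.pi ∧ t₂ ≠ -Real.pi) (hmem : t ∉ Set.Icc t₁ t₂) :
    Tendsto (fun N => chiPoly t₁ t₂ N t) atTop (𝓝 0) := by
  rcases lt_or_ge t t₁ with hlt | hge
  · exact tendsto_chiPoly_zero_of_gt (by linarith) (by linarith [h₁.2, ht.1]) (by linarith)
      (by linarith [h₂.2, ht.1])
  · have hgt : t₂ < t := not_le.1 fun hle => hmem ⟨hge, hle⟩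
    have hlt : ∀ s ∈ Set.Icc (-Real.pi) Real.pi, (t = Real.pi → s ≠ -Real.pi) →
        t - s < 2 * Real.pi := by
      intro s hs hne
      rcases ht.2.eq_or_lt with he | hl
      · have := lt_of_le_of_ne hs.1 (hne he).symm
        linarith
      · linarith [hs.1]
    exact tendsto_chiPoly_zero_of_lt (by linarith) (hlt _ h₁ fun he => (hend he).1) (by linarith)
      (hlt _ h₂ fun he => (hend he).2)

theorem neg_mem_Icc_pi {t : ℝ} (ht : t ∈ Set.Icc (-Real.pi) Real.pi) :
    -t ∈ Set.Icc (-Real.pi) Real.pi :=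
  ⟨neg_le_neg ht.2, by linarith [ht.1]⟩

/-- For angles of the same sign, the arc and its reflection meet at most at `0` and `π`. -/
theorem tendsto_chiPoly_zero_or_reflect {t₁ t₂ t : ℝ} (h₁ : t₁ ∈ Set.Ioc (-Real.pi) Real.pi)
    (h₂ : t₂ ∈ Set.Ioc (-Real.pi) Real.pi) (hsign : (0 ≤ t₁ ∧ 0 ≤ t₂) ∨ (t₁ ≤ 0 ∧ t₂ ≤ 0))
    (ht : t ∈ Set.Ioc (-Real.pi) Real.pi)
    (hts : t = 0 ∨ t = Real.pi → t ≠ t₁ ∧ t ≠ t₂) :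
    Tendsto (fun N => chiPoly (-t₂) (-t₁) N t) atTop (𝓝 0) ∨
      Tendsto (fun N => chiPoly t₁ t₂ N t) atTop (𝓝 0) := by
  have h₁' := h₁.1
  have h₂' := h₂.1
  have ht' := ht.1
  rcases hsign with ⟨p₁, p₂⟩ | ⟨p₁, p₂⟩
  · rcases lt_trichotomy t 0 with hneg | hzero | hpos
    · right
      exact tendsto_chiPoly_zero_of_gt (by linarith) (by linarith [h₁.2]) (by linarith)
        (by linarith [h₂.2])
    · right
      obtain ⟨n₁, n₂⟩ := hts (Or.inl hzero)
      rw [hzero] at n₁ n₂ ⊢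
      have q₁ := lt_of_le_of_ne p₁ n₁
      have q₂ := lt_of_le_of_ne p₂ n₂
      exact tendsto_chiPoly_zero_of_gt (by linarith) (by linarith [h₁.2]) (by linarith)
        (by linarith [h₂.2])
    · rcases ht.2.eq_or_lt with he | hlt
      · right
        obtain ⟨n₁, n₂⟩ := hts (Or.inr he)
        rw [he] at n₁ n₂ ⊢
        have q₁ := lt_of_le_of_ne h₁.2 n₁.symm
        have q₂ := lt_of_le_of_ne h₂.2 n₂.symm
        exact tendsto_chiPoly_zero_of_lt (by linarith) (by linarith) (by linarith) (by linarith)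
      · left
        exact tendsto_chiPoly_zero_of_lt (by linarith) (by linarith [h₂.2]) (by linarith)
          (by linarith [h₁.2])
  · rcases lt_trichotomy t 0 with hneg | hzero | hpos
    · left
      exact tendsto_chiPoly_zero_of_gt (by linarith) (by linarith) (by linarith) (by linarith)
    · right
      obtain ⟨n₁, n₂⟩ := hts (Or.inl hzero)
      rw [hzero] at n₁ n₂ ⊢
      have q₁ := lt_of_le_of_ne p₁ n₁.symm
      have q₂ := lt_of_le_of_ne p₂ n₂.symm
      exact tendsto_chiPoly_zero_of_lt (by linarith) (by linarith) (by linarith) (by linarith)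
    -- The frequency `t = π` needs no exception here, since `t₁, t₂ > -π` keeps the distances below
    -- `2π`.
    · right
      exact tendsto_chiPoly_zero_of_lt (by linarith) (by linarith [ht.2]) (by linarith)
        (by linarith [ht.2])

/-- The two complex equations amount to `rr + ii = 0`, `ri - ir = 0`, `rr - ii = 0` and `ri + ir =
0`, which force all four real moments to vanish. -/
theorem integral_re_im_mul_eq_zero {Ω : Type*} [MeasurableSpace Ω] {μ : Measure Ω}
    {f g : Ω → ℂ} (hf : MemLp f 2 μ) (hg : MemLp g 2 μ)
    (h : ∫ ω, starRingEnd ℂ (f ω) * g ω ∂μ = 0) (h' : ∫ ω, f ω * g ω ∂μ = 0) :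
    (∫ ω, (f ω).re * (g ω).re ∂μ = 0 ∧ ∫ ω, (f ω).re * (g ω).im ∂μ = 0) ∧
      ∫ ω, (f ω).im * (g ω).re ∂μ = 0 ∧ ∫ ω, (f ω).im * (g ω).im ∂μ = 0 := by
  have hi : Integrable (fun ω => starRingEnd ℂ (f ω) * g ω) μ := by
    refine MemLp.integrable_mul (p := 2) (q := 2) ?_ hg
    exact hf.star
  have hi' : Integrable (fun ω => f ω * g ω) μ := MemLp.integrable_mul hf hg
  have e1 := congrArg Complex.re h
  have e2 := congrArg Complex.im h
  have e3 := congrArg Complex.re h'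
  have e4 := congrArg Complex.im h'
  have re_int : ∀ {F : Ω → ℂ}, Integrable F μ → (∫ ω, F ω ∂μ).re = ∫ ω, (F ω).re ∂μ :=
    fun hF => (integral_re hF).symm
  have im_int : ∀ {F : Ω → ℂ}, Integrable F μ → (∫ ω, F ω ∂μ).im = ∫ ω, (F ω).im ∂μ :=
    fun hF => (integral_im hF).symm
  rw [re_int hi] at e1
  rw [im_int hi] at e2
  rw [re_int hi'] at e3
  rw [im_int hi'] at e4
  simp only [Complex.mul_re, Complex.mul_im, Complex.conj_re, Complex.conj_im, neg_mul,
    sub_neg_eq_add, Complex.zero_re, Complex.zero_im] at e1 e2 e3 e4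
  have fr : MemLp (fun ω => (f ω).re) 2 μ := hf.re
  have fi : MemLp (fun ω => (f ω).im) 2 μ := hf.im
  have gr : MemLp (fun ω => (g ω).re) 2 μ := hg.re
  have gi : MemLp (fun ω => (g ω).im) 2 μ := hg.im
  have rr : Integrable (fun ω => (f ω).re * (g ω).re) μ := fr.integrable_mul gr
  have ri : Integrable (fun ω => (f ω).re * (g ω).im) μ := fr.integrable_mul gi
  have ir : Integrable (fun ω => (f ω).im * (g ω).re) μ := fi.integrable_mul gr
  have ii : Integrable (fun ω => (f ω).im * (g ω).im) μ := fi.integrable_mul gi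
  rw [integral_add rr ii] at e1
  simp only [← sub_eq_add_neg] at e2
  rw [integral_sub ri ir] at e2
  rw [integral_sub rr ii] at e3
  rw [integral_add ri ir] at e4
  refine ⟨⟨?_, ?_⟩, ?_, ?_⟩ <;> linarith

variable {Ω : Type*} [MeasurableSpace Ω] {m : ℕ} {μ : Measure Ω} [IsProbabilityMeasure μ]
  {y : ℤ → Ω → EuclideanSpace ℝ (Fin m)}

/-- The real and imaginary parts of a complex vector. -/
def reImCLM (m : ℕ) : EuclideanSpace ℂ (Fin m) →L[ℝ] (Fin m → ℝ) × (Fin m → ℝ) :=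
  LinearMap.toContinuousLinearMap
    { toFun := fun z => (fun i => (z i).re, fun i => (z i).im)
      map_add' := fun a b => by
        ext i <;> simp
      map_smul' := fun r a => by
        ext i <;> simp }

/-- The pseudo-covariance is the inner product of `Z` with its conjugate, an increment over the
reflected arc `(-t₂, -t₁)`. -/
theorem IsSpectralIncrement.isCircularlySymmetricGaussian (hy : IsStationaryGaussian μ y)
    {t₁ t₂ : ℝ} (h₁ : t₁ ∈ Set.Ioc (-Real.pi) Real.pi) (h₂ : t₂ ∈ Set.Ioc (-Real.pi) Real.pi)
    (hsign : (0 ≤ t₁ ∧ 0 ≤ t₂) ∨ (t₁ ≤ 0 ∧ t₂ ≤ 0))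
    (hmass : t₁ ≠ t₂ → ∀ τ : ℝ, (τ = t₁ ∨ τ = t₂) → (τ = 0 ∨ τ = Real.pi) →
      NoSpectralMassAt μ y τ) {Z : Ω → EuclideanSpace ℂ (Fin m)}
    (hZ : IsSpectralIncrement μ y t₁ t₂ Z) : IsCircularlySymmetricGaussian μ Z where
  gaussian := (hZ.hasGaussianLaw_prod hy hZ).fst.map_fun (reImCLM m)
  mean_zero := hZ.integral_eq_zero hy
  pseudoCov_zero := fun i j => by
    have i₁ := Set.Ioc_subset_Icc_self h₁
    have i₂ := Set.Ioc_subset_Icc_self h₂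
    have key : ∀ {s : Set ℝ}, s.Countable → s ⊆ Set.Ioc (-Real.pi) Real.pi →
        (∀ τ ∈ s, NoSpectralMassAt μ y τ) →
        (∀ t ∈ Set.Ioc (-Real.pi) Real.pi, t ∉ s →
          Tendsto (fun N => chiPoly (-t₂) (-t₁) N t) atTop (𝓝 0) ∨
            Tendsto (fun N => chiPoly t₁ t₂ N t) atTop (𝓝 0)) →
        ∫ ω, Z ω i * Z ω j ∂μ = 0 := by
      intro s hs hs' hms h
      have := hZ.conj.integral_conj_mul_eq_zero hy hs hs' hms (neg_mem_Icc_pi i₂)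
        (neg_mem_Icc_pi i₁) i₁ i₂ h hZ i j
      simpa [conjVec] using this
    by_cases heq : t₁ = t₂
    -- For equal angles the kernel is identically zero, so no condition on the mass is needed.
    · refine key Set.countable_empty (Set.empty_subset _) (by simp) fun t _ _ => Or.inr ?_
      refine tendsto_const_nhds.congr fun N => ?_
      rw [heq, chiPoly_eq]
      simp
    -- The exceptional frequencies are the endpoints equal to `0` or `π`, the only places where both
    -- kernels can fail to vanish.
    · refine key (s := {τ | (τ = t₁ ∨ τ = t₂) ∧ (τ = 0 ∨ τ = Real.pi)}) ?_ ?_ ?_ ?_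
      · exact (Set.toFinite ({t₁, t₂} : Set ℝ)).countable.mono fun τ hτ => by simpa using hτ.1
      · rintro τ ⟨rfl | rfl, -⟩
        · exact h₁
        · exact h₂
      · exact fun τ hτ => hmass heq τ hτ.1 hτ.2
      · intro t ht hts
        refine tendsto_chiPoly_zero_or_reflect h₁ h₂ hsign ht fun h0 => ⟨fun he => ?_, fun he => ?_⟩
        · exact hts ⟨Or.inl he, h0⟩
        · exact hts ⟨Or.inr he, h0⟩

/-- The real and imaginary parts of a complex vector as a single family of real numbers. -/
def realCoords (m : ℕ) : EuclideanSpace ℂ (Fin m) →L[ℝ] (Fin m × Bool → ℝ) :=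
  LinearMap.toContinuousLinearMap
    { toFun := fun z p => if p.2 then (z p.1).re else (z p.1).im
      map_add' := fun a b => by
        ext ⟨i, b⟩
        cases b <;> simp
      map_smul' := fun r a => by
        ext ⟨i, b⟩
        cases b <;> simp }

theorem realCoords_apply (z : EuclideanSpace ℂ (Fin m)) (p : Fin m × Bool) :
    realCoords m z p = if p.2 then (z p.1).re else (z p.1).im := rfl

/-- A complex vector with given real coordinates. -/
def ofRealCoords (m : ℕ) (x : Fin m × Bool → ℝ) : EuclideanSpace ℂ (Fin m) :=
  WithLp.toLp 2 fun i => (x (i, true) : ℂ) + x (i, false) * Complex.I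

theorem measurable_ofRealCoords : Measurable (ofRealCoords m) := by
  refine Continuous.measurable ((PiLp.continuous_toLp 2 _).comp (continuous_pi fun i => ?_))
  fun_prop

theorem ofRealCoords_realCoords (z : EuclideanSpace ℂ (Fin m)) :
    ofRealCoords m (realCoords m z) = z := by
  ext i
  simp [ofRealCoords, realCoords_apply, Complex.re_add_im]

/-- Jointly Gaussian centered complex vectors are independent if their covariance and their
pseudo-covariance vanish. -/
theorem indepFun_of_integral_mul_eq_zero {Z Z' : Ω → EuclideanSpace ℂ (Fin m)}
    (hG : HasGaussianLaw (fun ω => (Z ω, Z' ω)) μ) (h0 : ∀ i, ∫ ω, Z ω i ∂μ = 0)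
    (h : ∀ i j, ∫ ω, starRingEnd ℂ (Z ω i) * Z' ω j ∂μ = 0)
    (h' : ∀ i j, ∫ ω, Z ω i * Z' ω j ∂μ = 0) : IndepFun Z Z' μ := by
  have hZ : ∀ i, MemLp (fun ω => Z ω i) 2 μ := memLp_two_coord hG.fst.memLp_two
  have hZ' : ∀ i, MemLp (fun ω => Z' ω i) 2 μ := memLp_two_coord hG.snd.memLp_two
  have hjoint : HasGaussianLaw (fun ω => (fun p => realCoords m (Z ω) p,
      fun p => realCoords m (Z' ω) p)) μ :=
    hG.map_fun (((realCoords m).comp (.fst ℝ _ _)).prod ((realCoords m).comp (.snd ℝ _ _)))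
  have hmem : ∀ {W : Ω → EuclideanSpace ℂ (Fin m)}, (∀ i, MemLp (fun ω => W ω i) 2 μ) →
      ∀ p, MemLp (fun ω => realCoords m (W ω) p) 2 μ := by
    rintro W hW ⟨i, b⟩
    cases b
    · exact (hW i).im
    · exact (hW i).re
  have hmean : ∀ p, ∫ ω, realCoords m (Z ω) p ∂μ = 0 := by
    rintro ⟨i, b⟩
    have hint := (hZ i).integrable one_le_two
    cases b
    · exact (integral_im hint).trans (by rw [h0 i]; simp)
    · exact (integral_re hint).trans (by rw [h0 i]; simp)
  have hcov : ∀ p q, cov[fun ω => realCoords m (Z ω) p, fun ω => realCoords m (Z' ω) q; μ] = 0 := by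
    intro p q
    rw [covariance_eq_sub (hmem hZ p) (hmem hZ' q), hmean p, zero_mul, sub_zero]
    obtain ⟨i, b⟩ := p
    obtain ⟨j, b'⟩ := q
    obtain ⟨⟨rr, ri⟩, ir, ii⟩ := integral_re_im_mul_eq_zero (hZ i) (hZ' j) (h i j) (h' i j)
    cases b <;> cases b'
    · exact ii
    · exact ir
    · exact ri
    · exact rr
  -- Uncorrelated jointly Gaussian real coordinates are independent, and the complex vectors are
  -- measurable functions of them.
  have hind := (hjoint.indepFun_of_covariance_eval hcov).comp
    (measurable_ofRealCoords (m := m)) (measurable_ofRealCoords (m := m))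
  have e : ∀ W : Ω → EuclideanSpace ℂ (Fin m),
      (ofRealCoords m ∘ fun ω p => realCoords m (W ω) p) = W := fun W =>
    funext fun ω => ofRealCoords_realCoords (W ω)
  rwa [e, e] at hind

/-- Disjointness from the second arc kills the covariance, and disjointness from its reflection
kills the pseudo-covariance. -/
theorem IsSpectralIncrement.indepFun (hy : IsStationaryGaussian μ y) {t₁ t₂ t₃ t₄ : ℝ}
    (h₁ : t₁ ∈ Set.Ioc (-Real.pi) Real.pi) (h₂ : t₂ ∈ Set.Ioc (-Real.pi) Real.pi)
    (h₃ : t₃ ∈ Set.Ioc (-Real.pi) Real.pi) (h₄ : t₄ ∈ Set.Ioc (-Real.pi) Real.pi)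
    (h₁₂ : t₁ ≤ t₂) (h₃₄ : t₃ ≤ t₄) (hdisj : Set.Icc t₁ t₂ ∩ Set.Icc t₃ t₄ = ∅)
    (hdisj' : Set.Icc t₁ t₂ ∩ Set.Icc (-t₄) (-t₃) = ∅) {Z Z' : Ω → EuclideanSpace ℂ (Fin m)}
    (hZ : IsSpectralIncrement μ y t₁ t₂ Z) (hZ' : IsSpectralIncrement μ y t₃ t₄ Z') :
    IndepFun Z Z' μ := by
  have i₁ := Set.Ioc_subset_Icc_self h₁
  have i₂ := Set.Ioc_subset_Icc_self h₂
  have i₃ := Set.Ioc_subset_Icc_self h₃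
  have i₄ := Set.Ioc_subset_Icc_self h₄
  have hout : ∀ t ∈ Set.Ioc (-Real.pi) Real.pi, t ∉ Set.Icc t₁ t₂ →
      Tendsto (fun N => chiPoly t₁ t₂ N t) atTop (𝓝 0) := fun t ht hmem =>
    tendsto_chiPoly_zero_of_notMem_Icc i₁ i₂ ht h₁₂ (fun _ => ⟨h₁.1.ne', h₂.1.ne'⟩) hmem
  refine indepFun_of_integral_mul_eq_zero (hZ.hasGaussianLaw_prod hy hZ')
    (hZ.integral_eq_zero hy) (fun i j => ?_) (fun i j => ?_)
  · refine hZ.integral_conj_mul_eq_zero hy Set.countable_empty (Set.empty_subset _) (by simp)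
      i₁ i₂ i₃ i₄ (fun t ht _ => ?_) hZ' i j
    by_cases hmem : t ∈ Set.Icc t₁ t₂
    · right
      exact tendsto_chiPoly_zero_of_notMem_Icc i₃ i₄ ht h₃₄ (fun _ => ⟨h₃.1.ne', h₄.1.ne'⟩)
        fun hm => Set.eq_empty_iff_forall_notMem.1 hdisj t ⟨hmem, hm⟩
    · exact Or.inl (hout t ht hmem)
  · have h := hZ'.conj.integral_conj_mul_eq_zero hy Set.countable_empty (Set.empty_subset _)
      (by simp) (neg_mem_Icc_pi i₄) (neg_mem_Icc_pi i₃) i₁ i₂ (fun t ht _ => ?_) hZ j i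
    · simpa [conjVec, mul_comm] using h
    by_cases hmem : t ∈ Set.Icc t₁ t₂
    · left
      refine tendsto_chiPoly_zero_of_notMem_Icc (neg_mem_Icc_pi i₄) (neg_mem_Icc_pi i₃) ht
        (neg_le_neg h₃₄) (fun he => ?_)
        fun hm => Set.eq_empty_iff_forall_notMem.1 hdisj' t ⟨hmem, hm⟩
      -- At `t = π` the reflected arc must not end at `-π`. If `t₄ = π`, the two original arcs would
      -- share the point `π`, contrary to `hdisj`.
      have h4 : t₄ ≠ Real.pi := fun h4 =>
        Set.eq_empty_iff_forall_notMem.1 hdisj t ⟨hmem, by linarith [ht.2, h₃.2], by linarith⟩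
      have h3 : t₃ ≠ Real.pi := fun h3 => h4 (le_antisymm h₄.2 (h3 ▸ h₃₄))
      exact ⟨fun e => h4 (neg_injective e), fun e => h3 (neg_injective e)⟩
    · exact Or.inr (hout t ht hmem)

end Properties

end SpectralRep

end

theorem mainTheorem4 {Ω : Type*} [MeasurableSpace Ω] (μ : Measure Ω) [IsProbabilityMeasure μ]
    {m : ℕ} (y : ℤ → Ω → EuclideanSpace ℝ (Fin m))
    (hy : SpectralRep.IsStationaryGaussian μ y) :
    -- the series defining the increments converges in mean square
    (∀ t₁ ∈ Set.Icc (-Real.pi) Real.pi, ∀ t₂ ∈ Set.Icc (-Real.pi) Real.pi,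
      SpectralRep.IsSpectralIncrement μ y t₁ t₂ (SpectralRep.yhat μ y t₁ t₂)) ∧
    -- Hermitian symmetry
    (∀ t₁ ∈ Set.Ioc (-Real.pi) Real.pi, ∀ t₂ ∈ Set.Ioc (-Real.pi) Real.pi,
      ∀ᵐ ω ∂μ, ∀ i : Fin m,
        SpectralRep.yhat μ y (-t₂) (-t₁) ω i = starRingEnd ℂ (SpectralRep.yhat μ y t₁ t₂ ω i)) ∧
    -- circular symmetry for angles of the same sign
    (∀ t₁ ∈ Set.Ioc (-Real.pi) Real.pi, ∀ t₂ ∈ Set.Ioc (-Real.pi) Real.pi,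
      ((0 ≤ t₁ ∧ 0 ≤ t₂) ∨ (t₁ ≤ 0 ∧ t₂ ≤ 0)) →
      (t₁ ≠ t₂ → ∀ τ : ℝ, (τ = t₁ ∨ τ = t₂) → (τ = 0 ∨ τ = Real.pi) →
        SpectralRep.NoSpectralMassAt μ y τ) →
      SpectralRep.IsCircularlySymmetricGaussian μ (SpectralRep.yhat μ y t₁ t₂)) ∧
    -- independence
    (∀ t₁ ∈ Set.Ioc (-Real.pi) Real.pi, ∀ t₂ ∈ Set.Ioc (-Real.pi) Real.pi,
      ∀ t₃ ∈ Set.Ioc (-Real.pi) Real.pi, ∀ t₄ ∈ Set.Ioc (-Real.pi) Real.pi,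
      t₁ ≤ t₂ → t₃ ≤ t₄ →
      Set.Icc t₁ t₂ ∩ Set.Icc t₃ t₄ = ∅ →
      Set.Icc t₁ t₂ ∩ Set.Icc (-t₄) (-t₃) = ∅ →
      IndepFun (SpectralRep.yhat μ y t₁ t₂) (SpectralRep.yhat μ y t₃ t₄) μ) := by
  have hinc : ∀ t₁ ∈ Set.Icc (-Real.pi) Real.pi, ∀ t₂ ∈ Set.Icc (-Real.pi) Real.pi,
      SpectralRep.IsSpectralIncrement μ y t₁ t₂ (SpectralRep.yhat μ y t₁ t₂) :=
    fun t₁ h₁ t₂ h₂ => SpectralRep.isSpectralIncrement_yhat hy h₁ h₂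
  have hinc' : ∀ t₁ ∈ Set.Ioc (-Real.pi) Real.pi, ∀ t₂ ∈ Set.Ioc (-Real.pi) Real.pi,
      SpectralRep.IsSpectralIncrement μ y t₁ t₂ (SpectralRep.yhat μ y t₁ t₂) :=
    fun t₁ h₁ t₂ h₂ => hinc t₁ (Set.Ioc_subset_Icc_self h₁) t₂ (Set.Ioc_subset_Icc_self h₂)
  refine ⟨hinc, fun t₁ h₁ t₂ h₂ => ?_, fun t₁ h₁ t₂ h₂ hsign hmass => ?_,
    fun t₁ h₁ t₂ h₂ t₃ h₃ t₄ h₄ h₁₂ h₃₄ hd hd' => ?_⟩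
  -- Convergence on the closed interval is used because `-t₂` or `-t₁` may be `-π`. The symmetry
  -- then follows from uniqueness of mean-square limits.
  · have hneg := hinc (-t₂) (SpectralRep.neg_mem_Icc_pi (Set.Ioc_subset_Icc_self h₂)) (-t₁)
      (SpectralRep.neg_mem_Icc_pi (Set.Ioc_subset_Icc_self h₁))
    filter_upwards [hneg.ae_eq hy (hinc' t₁ h₁ t₂ h₂).conj] with ω hω i
    rw [hω]
    rfl
  · exact (hinc' t₁ h₁ t₂ h₂).isCircularlySymmetricGaussian hy h₁ h₂ hsign hmass
  · exact (hinc' t₁ h₁ t₂ h₂).indepFun hy h₁ h₂ h₃ h₄ h₁₂ h₃₄ hd hd' (hinc' t₃ h₃ t₄ h₄)
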